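/- A 3-uniform hypergraph consists of a vertex set and a set of hyperedges, each of which is a set of exactly three vertices. An embedding $A\to B$ of 3-uniform hypergraphs is an injection $f$ of the vertex sets such that a set $e$ of vertices of $A$ is a hyperedge of $A$ if and only if $f[e]$ is a hyperedge of $B$; $\binom{B}{A}$ denotes the set of all embeddings of $A$ into $B$. Let $\mathbf H$ be the countable universal homogeneous 3-uniform hypergraph, i.e. the (up to isomorphism unique) countable 3-uniform hypergraph such that every isomorphism between finite induced sub-hypergraphs of $\mathbf H$ extends to an automorphism of $\mathbf H$, and every countable 3-uniform hypergraph embeds into $\mathbf H$. Theorem. The hypergraph $\mathbf H$ has finite big Ramsey degrees. That is, for every finite 3-uniform hypergraph $\mathbf A$ there is a natural number $\ell=\ell(\mathbf A)$ such that for every $k\in\mathbb N$ and every colouring $\chi\colon\binom{\mathbf H}{\mathbf A}\to\{0,\dots,k-1\}$ there is an embedding $f\colon\mathbf H\to\mathbf H$ such that $\chi$ takes at most $\ell$ different values on $\binom{f[\mathbf H]}{\mathbf A}$, the set of those embeddings of $\mathbf A$ into $\mathbf H$ whose image is contained in $f[\mathbf H]$. Equivalently, for every finite induced sub-hypergraph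 $\mathbf A$ of $\mathbf H$, the big Ramsey degree of $\mathbf A$ in $\mathbf H$ (the least $\ell\in\mathbb N\cup\{\infty\}$ with the above property for all $k\in\mathbb N$) is finite. -/

import Mathlib

open scoped Hypergraph

namespace Hypergraph

universe u v w

/-- A hypergraph is `r`-uniform if every hyperedge has exactly `r` vertices. -/
def IsUniform {α : Type u} (H : Hypergraph α) (r : ℕ) : Prop :=
  ∀ e ∈ E(H), e.encard = r

/-- The sub-hypergraph of `H` induced on the vertices that lie in `s`. -/
def induce {α : Type u} (H : Hypergraph α) (s : Set α) : Hypergraph α where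
  vertexSet := V(H) ∩ s
  edgeSet := {e | e ∈ E(H) ∧ e ⊆ s}
  subset_vertexSet_of_mem_edgeSet' := fun _ he =>
    Set.subset_inter (H.subset_vertexSet_of_mem_edgeSet he.1) he.2

/-- An embedding of hypergraphs: an injection between the vertex sets under which a set of
vertices is a hyperedge if and only if its image is a hyperedge. -/
structure Embedding {α : Type u} {β : Type v} (A : Hypergraph α) (B : Hypergraph β) where
  toFun : V(A) → V(B)
  injective : Function.Injective toFun
  map_edge_iff : ∀ e : Set V(A),
    (fun x : V(A) => (toFun x : β)) '' e ∈ E(B) ↔ (fun x : V(A) => (x : α)) '' e ∈ E(A)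

/-- The set of vertices in the image of an embedding. -/
def Embedding.range {α : Type u} {β : Type v} {A : Hypergraph α} {B : Hypergraph β}
    (f : A.Embedding B) : Set V(B) :=
  Set.range f.toFun

/-- An isomorphism of hypergraphs is a surjective embedding. -/
structure Iso {α : Type u} {β : Type v} (A : Hypergraph α) (B : Hypergraph β)
    extends Embedding A B where
  surjective : Function.Surjective toFun

/-- Every isomorphism between finite induced sub-hypergraphs extends to an automorphism. -/
def IsHomogeneous {α : Type u} (H : Hypergraph α) : Prop :=
  ∀ s t : Set α, s ⊆ V(H) → t ⊆ V(H) → s.Finite → t.Finite →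
    ∀ f : (H.induce s).Iso (H.induce t), ∃ g : H.Iso H,
      ∀ x : V(H.induce s), (g.toFun ⟨x, x.2.1⟩ : α) = f.toFun x

/-- Every countable `r`-uniform hypergraph embeds into `H`. A countable hypergraph on
a type of any universe is isomorphic to one on a type in `Type`. -/
def IsUniversal {α : Type u} (H : Hypergraph α) (r : ℕ) : Prop :=
  ∀ (β : Type) (G : Hypergraph β), V(G).Countable → G.IsUniform r → Nonempty (G.Embedding H)

/-- `H` is the countable universal homogeneous 3-uniform hypergraph (which is unique up to
isomorphism). -/
structure IsUniversalHomogeneous3 {α : Type u} (H : Hypergraph α) : Prop where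
  countable : V(H).Countable
  uniform : H.IsUniform 3
  homogeneous : H.IsHomogeneous
  universal : H.IsUniversal 3

/-- The partition arrow `C ⟶ (B)^A_{k,ℓ}`: for every colouring `χ` with `k` colours of the
embeddings of `A` into `C` there is an embedding `f` of `B` into `C` such that `χ` takes at most
`ℓ` values on the embeddings of `A` into the sub-hypergraph `f[B]` of `C`. -/
def Arrow {α : Type u} {β : Type v} {γ : Type w}
    (C : Hypergraph γ) (B : Hypergraph β) (A : Hypergraph α) (k : ℕ) (l : ℕ∞) : Prop :=
  ∀ χ : A.Embedding C → Fin k, ∃ f : B.Embedding C,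
    (χ '' {e : A.Embedding C | e.range ⊆ f.range}).encard ≤ l

/-- The big Ramsey degree of `A` in `B`: the least `ℓ ∈ ω + 1` such that `B ⟶ (B)^A_{k,ℓ}` for
every finite `k`. -/
noncomputable def bigRamseyDegree {α : Type u} {β : Type v}
    (B : Hypergraph β) (A : Hypergraph α) : ℕ∞ :=
  sInf {l : ℕ∞ | ∀ k : ℕ, Arrow B B A k l}

/-- The big Ramsey degree in `B` of every finite induced sub-hypergraph of `B` is finite. -/
def HasFiniteBigRamseyDegrees {α : Type u} (B : Hypergraph α) : Prop :=
  ∀ s : Set α, s ⊆ V(B) → s.Finite → B.bigRamseyDegree (B.induce s) < ⊤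

end Hypergraph

/-! Enumerate the vertices of the hypergraph. Vertex `k` is described by a triangular 0-1 array
recording for which `i < j` the triple `i, j, k` is a hyperedge. Arrays whose row `r` has length `r`
form a finitely branching tree: a node is extended by appending a row, and each row is itself a node
of the binary tree. Lists are kept newest first, so "initial segment" is `<:+`. Declaring `x, y, z`
with `|x| < |y| < |z|` a hyperedge when the entry of `z` in row `|y|` and column `|x|` is `true`
gives a countable 3-uniform hypergraph `treeGraph`. It embeds into `H` by universality, and `H`
embeds into it by codes.

A `StrongMap` embeds both trees at once as strong subtrees on common levels, so that an appended row
`a` turns into the row `B a`. It preserves the relevant entries (`rel_map_iff`), hence acts on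
`treeGraph`. Two facts carry the proof.

Ramsey theorem (`exists_const_comp`): a finite colouring of strong maps that depends only on the
levels below `h` is constant on all `f.comp g` for a suitable `f`. As in Milliken's theorem this is
an induction on `h`: the Halpern–Läuchli theorem, applied to all nodes of one level of both trees
together, gives a one-step pigeonhole principle (`exists_const_of_local`), and a fusion makes the
colour independent of the last level (`exists_local_comp`).

Envelopes (`exists_envelope`): the codes of `n` vertices lie in the image, under some strong map, of
the levels below a bound depending only on `n`. So a copy of `A` among the codes is given by a
strong map and one of finitely many position vectors. After composing with the `f` of the Ramsey
theorem its colour depends on the position vector alone, and the number of these vectors bounds the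
number of colours (`exists_arrow`).

The Halpern–Läuchli theorem `hasHL` is proved by induction on the number of trees. Nodes of the
additional tree are replaced by branches through them, along which a colouring of the remaining
trees arises; `free_of_hasHL` shows that one colour can be forced, and `exists_strong_of_free` turns
this into strong subtrees. -/

namespace HalpernLauchli

/-! ### Trees given by levels, and strong subtrees as dominating sets of nodes -/

/-- The levels `U 0, U 1, …` of a finitely branching tree without terminal nodes. -/
structure IsTree {N : Type} [Preorder N] (U : ℕ → Set N) : Prop where
  finite : ∀ n, (U n).Finite
  ext : ∀ n, ∀ s ∈ U n, ∃ x ∈ U (n + 1), s ≤ x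
  unique : ∀ n, ∀ s ∈ U n, ∀ s' ∈ U n, ∀ z, s ≤ z → s' ≤ z → s = s'

/-- `S` is a strong subtree of `U`, with `n`-th level inside level `φ n` of `U`. -/
structure IsStrong {N : Type} [Preorder N] (φ : ℕ → ℕ) (S U : ℕ → Set N) : Prop where
  mono : StrictMono φ
  mem : ∀ n, S n ⊆ U (φ n)
  dom : ∀ n, ∀ s ∈ S n, ∀ y ∈ U (φ n + 1), s ≤ y → ∃ x ∈ S (n + 1), y ≤ x

section Trees

variable {N : Type} [Preorder N]

theorem IsTree.exists_above {U : ℕ → Set N} (hU : IsTree U) {n m : ℕ} (h : n ≤ m) {s : N}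
    (hs : s ∈ U n) : ∃ x ∈ U m, s ≤ x := by
  induction m, h using Nat.le_induction with
  | base => exact ⟨s, hs, le_rfl⟩
  | succ m _ ih =>
    obtain ⟨x, hx, hsx⟩ := ih
    obtain ⟨y, hy, hxy⟩ := hU.ext m x hx
    exact ⟨y, hy, hsx.trans hxy⟩

theorem IsStrong.isTree {φ : ℕ → ℕ} {S U : ℕ → Set N} (h : IsStrong φ S U) (hU : IsTree U) :
    IsTree S where
  finite n := (hU.finite _).subset (h.mem n)
  ext n s hs := by
    obtain ⟨y, hy, hsy⟩ := hU.ext _ s (h.mem n hs)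
    obtain ⟨x, hx, hyx⟩ := h.dom n s hs y hy hsy
    exact ⟨x, hx, hsy.trans hyx⟩
  unique n s hs s' hs' := hU.unique _ s (h.mem n hs) s' (h.mem n hs')

theorem IsStrong.trans {φ ψ : ℕ → ℕ} {R S U : ℕ → Set N} (h : IsStrong ψ R S)
    (h' : IsStrong φ S U) : IsStrong (φ ∘ ψ) R U where
  mono := h'.mono.comp h.mono
  mem n := (h.mem n).trans (h'.mem _)
  dom n s hs y hy hsy := by
    obtain ⟨x, hx, hyx⟩ := h'.dom _ s (h.mem n hs) y hy hsy
    obtain ⟨z, hz, hxz⟩ := h.dom n s hs x hx (hsy.trans hyx)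
    exact ⟨z, hz, hyx.trans hxz⟩

theorem IsStrong.refl (U : ℕ → Set N) : IsStrong id U U where
  mono := strictMono_id
  mem _ := subset_rfl
  dom _ _ _ y hy _ := ⟨y, hy, le_rfl⟩

theorem IsTree.isStrong_comp {U : ℕ → Set N} (hU : IsTree U) {φ : ℕ → ℕ} (hφ : StrictMono φ) :
    IsStrong φ (U ∘ φ) U where
  mono := hφ
  mem _ := subset_rfl
  dom n _ _ _ hy _ := hU.exists_above (hφ (Nat.lt_succ_self n)) hy

/-- The part of a strong subtree above a node. -/
theorem IsStrong.cone {φ : ℕ → ℕ} {S U : ℕ → Set N} (h : IsStrong φ S U) (r : N) :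
    IsStrong φ (fun n => {y | r ≤ y ∧ y ∈ S n}) U where
  mono := h.mono
  mem n _ hy := h.mem n hy.2
  dom n s hs y hy hsy := by
    obtain ⟨x, hx, hyx⟩ := h.dom n s hs.2 y hy hsy
    exact ⟨x, ⟨hs.1.trans (hsy.trans hyx), hx⟩, hyx⟩

theorem IsStrong.shift {φ : ℕ → ℕ} {S U : ℕ → Set N} (h : IsStrong φ S U) (k : ℕ) :
    IsStrong (fun n => φ (k + n)) (fun n => S (k + n)) U where
  mono := h.mono.comp fun _ _ h => Nat.add_lt_add_left h k
  mem _ := h.mem _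
  dom n := h.dom (k + n)

end Trees

/-- The Halpern–Läuchli property for vectors of trees indexed by `ι`. -/
def HasHL (ι N : Type) [Preorder N] : Prop :=
  ∀ (C : Type) [Finite C] (U : ι → ℕ → Set N), (∀ i, IsTree (U i)) → (∀ i, (U i 0).Nonempty) →
    ∀ c : ℕ → (ι → N) → C, ∃ (φ : ℕ → ℕ) (S : ι → ℕ → Set N) (ε : C), StrictMono φ ∧
      (∀ i, IsStrong φ (S i) (U i)) ∧ (∀ i, (S i 0).Nonempty) ∧
      ∀ n x, (∀ i, x i ∈ S i n) → c (φ n) x = ε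

/-! ### Refinable finite approximations for the Halpern–Läuchli theorem -/

/-- Finitely many nodes in each of the trees `U i`, each carrying a strong subtree above it,
all with the same levels. -/
structure State {ι N : Type} [Preorder N] (U : ι → ℕ → Set N) where
  lev : ℕ → ℕ
  J : ι → Set N
  V : ι → N → ℕ → Set N
  lev_mono : StrictMono lev
  finite : ∀ i, (J i).Finite
  strong : ∀ i, ∀ x ∈ J i, IsStrong lev (V i x) (U i)
  root : ∀ i, ∀ x ∈ J i, x ∈ V i x 0
  above : ∀ i, ∀ x ∈ J i, ∀ n, ∀ y ∈ V i x n, x ≤ y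

namespace State

variable {ι N : Type} [Preorder N] {U : ι → ℕ → Set N}

/-- `a` refines `b`. -/
def Le (a b : State U) : Prop :=
  ∃ φ : ℕ → ℕ, StrictMono φ ∧ a.lev = b.lev ∘ φ ∧
    (∀ i, ∀ x ∈ b.J i, ∃ x' ∈ a.J i, x ≤ x') ∧
    ∀ i, ∀ x' ∈ a.J i, ∃ x ∈ b.J i, ∀ n, a.V i x' n ⊆ b.V i x (φ n)

theorem Le.refl (a : State U) : a.Le a :=
  ⟨id, strictMono_id, rfl, fun _ x hx => ⟨x, hx, le_rfl⟩, fun _ x hx => ⟨x, hx, fun _ => subset_rfl⟩⟩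

theorem Le.trans {a b d : State U} (h : a.Le b) (h' : b.Le d) : a.Le d := by
  obtain ⟨φ, hφ, hl, h1, h2⟩ := h
  obtain ⟨ψ, hψ, hl', h1', h2'⟩ := h'
  refine ⟨ψ ∘ φ, hψ.comp hφ, by rw [hl, hl']; rfl, fun i x hx => ?_, fun i x hx => ?_⟩
  · obtain ⟨y, hy, hxy⟩ := h1' i x hx
    obtain ⟨z, hz, hyz⟩ := h1 i y hy
    exact ⟨z, hz, hxy.trans hyz⟩
  · obtain ⟨y, hy, hxy⟩ := h2 i x hx
    obtain ⟨z, hz, hyz⟩ := h2' i y hy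
    exact ⟨z, hz, fun n => (hxy n).trans (hyz _)⟩

theorem mem_level (a : State U) {i : ι} {x : N} (hx : x ∈ a.J i) : x ∈ U i (a.lev 0) :=
  (a.strong i x hx).mem 0 (a.root i x hx)

/-- A node of a refinement lies above a unique node of the given state. -/
theorem Le.exists_below {a b : State U} (h : a.Le b) {i : ι} {x' : N} (hx' : x' ∈ a.J i) :
    ∃ x ∈ b.J i, x ≤ x' := by
  obtain ⟨φ, hφ, hl, h1, h2⟩ := h
  obtain ⟨x, hx, hs⟩ := h2 i x' hx'
  exact ⟨x, hx, b.above i x hx _ _ (hs 0 (a.root i x' hx'))⟩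

theorem eq_of_le (hU : ∀ i, IsTree (U i)) (a : State U) {i : ι} {x y z : N} (hx : x ∈ a.J i)
    (hy : y ∈ a.J i) (hxz : x ≤ z) (hyz : y ≤ z) : x = y :=
  (hU i).unique _ x (a.mem_level hx) y (a.mem_level hy) z hxz hyz

theorem Le.le_of_le (hU : ∀ i, IsTree (U i)) {a b : State U} (h : a.Le b) {i : ι} {x y z : N}
    (hx : x ∈ b.J i) (hy : y ∈ a.J i) (hxz : x ≤ z) (hyz : y ≤ z) : x ≤ y := by
  obtain ⟨x', hx', hxy⟩ := h.exists_below hy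
  rwa [b.eq_of_le hU hx hx' hxz (hxy.trans hyz)]

/-- Move to the `k`-th level of all the subtrees carried by the state. -/
def expand (hU : ∀ i, IsTree (U i)) (a : State U) (k : ℕ) : State U where
  lev n := a.lev (k + n)
  J i := {y | ∃ x ∈ a.J i, y ∈ a.V i x k}
  V i y n := {z | y ≤ z ∧ ∃ x ∈ a.J i, x ≤ y ∧ z ∈ a.V i x (k + n)}
  lev_mono := a.lev_mono.comp fun _ _ h => Nat.add_lt_add_left h k
  finite i := ((hU i).finite (a.lev k)).subset fun y ⟨x, hx, hy⟩ => (a.strong i x hx).mem k hy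
  strong i y hy := by
    obtain ⟨x, hx, hxy⟩ := hy
    convert ((a.strong i x hx).shift k).cone y using 4 with n z
    refine and_congr_right fun _ => ⟨?_, fun h => ⟨x, hx, a.above i x hx _ _ hxy, h⟩⟩
    rintro ⟨x', hx', hle, hz⟩
    rwa [a.eq_of_le hU hx hx' (a.above i x hx _ _ hxy) hle]
  root i y hy := by
    obtain ⟨x, hx, hxy⟩ := hy
    exact ⟨le_rfl, x, hx, a.above i x hx _ _ hxy, hxy⟩
  above _ _ _ _ _ hz := hz.1

theorem expand_le (hU : ∀ i, IsTree (U i)) (a : State U) (k : ℕ) : (a.expand hU k).Le a := by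
  refine ⟨fun n => k + n, fun _ _ h => Nat.add_lt_add_left h k, rfl, fun i x hx => ?_,
    fun i y hy => ?_⟩
  · obtain ⟨y, hy, hxy⟩ := ((a.strong i x hx).isTree (hU i)).exists_above (Nat.zero_le k)
      (a.root i x hx)
    exact ⟨y, ⟨x, hx, hy⟩, hxy⟩
  · obtain ⟨x, hx, hxy⟩ := hy
    refine ⟨x, hx, fun n z hz => ?_⟩
    obtain ⟨-, x', hx', hle, hz⟩ := hz
    rwa [a.eq_of_le hU hx hx' (a.above i x hx _ _ hxy) hle]

/-- Keep only some of the nodes. -/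
def restrict (a : State U) (J' : ι → Set N) (h : ∀ i, J' i ⊆ a.J i) : State U where
  lev := a.lev
  J := J'
  V := a.V
  lev_mono := a.lev_mono
  finite i := (a.finite i).subset (h i)
  strong i x hx := a.strong i x (h i hx)
  root i x hx := a.root i x (h i hx)
  above i x hx := a.above i x (h i hx)

/-- A tuple of nodes of the state. -/
def Tuple (a : State U) (f : ι → N) : Prop := ∀ i, f i ∈ a.J i

theorem finite_tuples [Finite ι] (a : State U) : {f | a.Tuple f}.Finite :=
  Set.Finite.pi' a.finite

theorem Le.exists_tuple {a b : State U} (h : a.Le b) {f : ι → N} (hf : b.Tuple f) :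
    ∃ g, a.Tuple g ∧ ∀ i, f i ≤ g i := by
  obtain ⟨φ, -, -, h1, -⟩ := h
  choose g hg using fun i => h1 i (f i) (hf i)
  exact ⟨g, fun i => (hg i).1, fun i => (hg i).2⟩

theorem exists_state (hne : ∀ i, (U i 0).Nonempty) :
    ∃ a : State U, ∃ f, a.Tuple f := by
  choose f hf using hne
  refine ⟨{ lev := id, J := fun i => {f i}, V := fun i x n => {y | x ≤ y ∧ y ∈ U i n},
            lev_mono := strictMono_id, finite := fun i => Set.finite_singleton _,
            strong := fun i x _ => (IsStrong.refl (U i)).cone x,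
            root := ?_, above := fun i x _ n y hy => hy.1 }, f, fun i => rfl⟩
  rintro i x rfl
  exact ⟨le_rfl, hf i⟩

/-- All tuples of the subtrees above the tuple `f` have colour `ε`. -/
def Hom {C : Type} (c : ℕ → (ι → N) → C) (ε : C) (a : State U) (f : ι → N) : Prop :=
  ∀ g, a.Tuple g → (∀ i, f i ≤ g i) → ∀ k y, (∀ i, y i ∈ a.V i (g i) k) → c (a.lev k) y = ε

/-- A tuple of `a` above `f` lies above a tuple of `b` that is itself above `f`: nodes of `b`
comparable with `f i` cannot branch off below it, since `b` refines the state `d` in which `f`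
lives. -/
theorem Hom.mono (hU : ∀ i, IsTree (U i)) {C : Type} {c : ℕ → (ι → N) → C} {ε : C}
    {a b d : State U} (hab : a.Le b) (hbd : b.Le d) {f : ι → N} (hf : d.Tuple f)
    (h : Hom c ε b f) : Hom c ε a f := by
  intro g hg hfg k y hy
  have hab' := hab
  obtain ⟨φ, hφ, hl, h1, h2⟩ := hab
  choose g' hg' hV using fun i => h2 i (g i) (hg i)
  have hle : ∀ i, f i ≤ g' i := fun i =>
    hbd.le_of_le hU (hf i) (hg' i) (hfg i)
      (b.above i _ (hg' i) _ _ (hV i 0 (a.root i _ (hg i))))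
  rw [hl]
  exact h g' hg' hle (φ k) y fun i => hV i k (hy i)

end State

end HalpernLauchli

/-! ### The inductive step of the Halpern–Läuchli theorem -/

namespace HalpernLauchli

namespace State

variable {ι N : Type} [Preorder N] {U : ι → ℕ → Set N}

/-- The tuples in `F` are treated one after another by the Halpern–Läuchli property; constancy
obtained earlier survives the passage to strong subtrees. -/
theorem exists_const_on (hHL : HasHL ι N) (hU : ∀ i, IsTree (U i)) {C : Type} [Finite C]
    (c : ℕ → (ι → N) → C) (a : State U) {F : Set (ι → N)} (hF : F.Finite)
    (hFa : ∀ f ∈ F, a.Tuple f) :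
    ∃ (φ : ℕ → ℕ) (Y : ι → N → ℕ → Set N), StrictMono φ ∧
      (∀ i, ∀ x ∈ a.J i, IsStrong φ (Y i x) (a.V i x) ∧ (Y i x 0).Nonempty) ∧
      ∀ f ∈ F, ∃ ε, ∀ n y, (∀ i, y i ∈ Y i (f i) n) → c (a.lev (φ n)) y = ε := by
  classical
  induction F, hF using Set.Finite.induction_on with
  | empty =>
    exact ⟨id, a.V, strictMono_id, fun i x hx => ⟨IsStrong.refl _, x, a.root i x hx⟩,
      fun f hf => hf.elim⟩
  | @insert f F _ _ ih =>
    obtain ⟨φ, Y, hφ, hY, hc⟩ := ih fun g hg => hFa g (Set.mem_insert_of_mem _ hg)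
    have hf := hFa f (Set.mem_insert _ _)
    have hT : ∀ i, ∀ x ∈ a.J i, IsTree (Y i x) := fun i x hx =>
      (hY i x hx).1.isTree ((a.strong i x hx).isTree (hU i))
    obtain ⟨ψ, S, ε, hψ, hS, hS0, hε⟩ := hHL C (fun i => Y i (f i)) (fun i => hT i _ (hf i))
      (fun i => (hY i _ (hf i)).2) fun n y => c (a.lev (φ n)) y
    have hsub : ∀ i x n, (if x = f i then S i else Y i x ∘ ψ) n ⊆ Y i x (ψ n) := by
      intro i x n
      split_ifs with h
      · subst h; exact (hS i).mem n
      · exact subset_rfl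
    -- Trees that do not take part in the tuple `f` are only thinned to the levels `ψ`, which keeps
    -- the levels common to all trees.
    refine ⟨φ ∘ ψ, fun i x => if x = f i then S i else Y i x ∘ ψ, hφ.comp hψ, fun i x hx => ?_,
      fun g hg => ?_⟩
    · beta_reduce
      split_ifs with h
      · subst h
        exact ⟨(hS i).trans (hY i _ hx).1, hS0 i⟩
      · refine ⟨((hT i x hx).isStrong_comp hψ).trans (hY i x hx).1, ?_⟩
        obtain ⟨y, hy⟩ := (hY i x hx).2
        obtain ⟨z, hz, -⟩ := (hT i x hx).exists_above (Nat.zero_le (ψ 0)) hy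
        exact ⟨z, hz⟩
    · rcases hg with rfl | hg
      · refine ⟨ε, fun n y hy => hε n y fun i => ?_⟩
        simpa using hy i
      · obtain ⟨δ, hδ⟩ := hc g hg
        exact ⟨δ, fun n y hy => hδ (ψ n) y fun i => hsub _ _ _ (hy i)⟩

/-- The colour of a tuple of the state is inherited by everything above it. -/
def Decided {C : Type} (c : ℕ → (ι → N) → C) (a : State U) : Prop :=
  ∀ g, a.Tuple g → ∀ k y, (∀ i, y i ∈ a.V i (g i) k) → c (a.lev k) y = c (a.lev 0) g

/-- Once every tuple of nodes has a constant colour on the subtrees above it, choosing one root in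
each subtree gives a state whose tuples already show that colour. -/
theorem exists_decided [Finite ι] (hHL : HasHL ι N) (hU : ∀ i, IsTree (U i)) {C : Type} [Finite C]
    (c : ℕ → (ι → N) → C) (a : State U) : ∃ b : State U, b.Le a ∧ Decided c b := by
  classical
  obtain ⟨φ, Y, hφ, hY, hc⟩ := exists_const_on hHL hU c a a.finite_tuples fun f hf => hf
  choose! r hr using fun i x hx => (hY i x hx).2
  have hle : ∀ i, ∀ x ∈ a.J i, x ≤ r i x := fun i x hx =>
    a.above i x hx _ _ ((hY i x hx).1.mem 0 (hr i x hx))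
  have huniq : ∀ i, ∀ x ∈ a.J i, ∀ x' ∈ a.J i, r i x = r i x' → x = x' := fun i x hx x' hx' h =>
    a.eq_of_le hU hx hx' (hle i x hx) (h ▸ hle i x' hx')
  let b : State U :=
    { lev := a.lev ∘ φ
      J := fun i => r i '' a.J i
      V := fun i z n => {y | z ≤ y ∧ ∃ x ∈ a.J i, r i x = z ∧ y ∈ Y i x n}
      lev_mono := a.lev_mono.comp hφ
      finite := fun i => (a.finite i).image _
      strong := by
        rintro i _ ⟨x, hx, rfl⟩
        convert ((hY i x hx).1.trans (a.strong i x hx)).cone (r i x) using 4 with n z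
        refine and_congr_right fun _ => ⟨?_, fun h => ⟨x, hx, rfl, h⟩⟩
        rintro ⟨x', hx', he, hz⟩
        rwa [← huniq i x' hx' x hx he]
      root := by
        rintro i _ ⟨x, hx, rfl⟩
        exact ⟨le_rfl, x, hx, rfl, hr i x hx⟩
      above := fun i x hx n y hy => hy.1 }
  refine ⟨b, ⟨φ, hφ, rfl, fun i x hx => ⟨r i x, ⟨x, hx, rfl⟩, hle i x hx⟩, ?_⟩, ?_⟩
  · rintro i _ ⟨x, hx, rfl⟩
    refine ⟨x, hx, ?_⟩
    rintro n y ⟨-, x', hx', he, hy⟩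
    rw [← huniq i x' hx' x hx he]
    exact (hY i x' hx').1.mem n hy
  · intro g hg
    choose f hf hfg using hg
    obtain ⟨ε, hε⟩ := hc f hf
    have key : ∀ k y, (∀ i, y i ∈ b.V i (g i) k) → c (b.lev k) y = ε := by
      intro k y hy
      refine hε k y fun i => ?_
      obtain ⟨-, x', hx', he, hz⟩ := hy i
      rwa [← huniq i x' hx' (f i) (hf i) (he.trans (hfg i).symm)]
    intro k y hy
    rw [key k y hy, key 0 g fun i => b.root i _ ⟨f i, hf i, hfg i⟩]

variable {W : ℕ → Set N} {C : Type}

/-- A refinement of the state together with a later branch that is homogeneous above `f`. -/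
def Succeeds (br : ℕ → N → ℕ → N) (W : ℕ → Set N) (c : ℕ → (ι → N) → N → C) (ε : C) (f : ι → N)
    (a : State U) (n : ℕ) (w : N) : Prop :=
  ∃ a' : State U, a'.Le a ∧ ∃ n' w', n ≤ n' ∧ w' ∈ W n' ∧ w ≤ w' ∧
    Hom (fun m y => c m y (br n' w' m)) ε a' f

theorem Succeeds.mono {br : ℕ → N → ℕ → N} {c : ℕ → (ι → N) → N → C} {ε : C} {f : ι → N}
    {a b : State U} {n n' : ℕ} {w w' : N} (hab : a.Le b) (hn : n ≤ n') (hw : w ≤ w')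
    (h : Succeeds br W c ε f a n' w') : Succeeds br W c ε f b n w := by
  obtain ⟨a', ha', m, v, hm, hv, hle, hh⟩ := h
  exact ⟨a', ha'.trans hab, m, v, hn.trans hm, hv, hw.trans hle, hh⟩

/-- Success is available at every node of `Y`, so it can be achieved for all of them by successive
refinements; homogeneity reached for one node persists in later refinements. -/
theorem exists_dominating (hU : ∀ i, IsTree (U i)) (br : ℕ → N → ℕ → N)
    (hbr : ∀ n, ∀ w ∈ W n, ∀ m, n ≤ m → br n w m ∈ W m ∧ w ≤ br n w m)
    (c : ℕ → (ι → N) → N → C) (ε : C) {f : ι → N} {t s : State U} (hf : t.Tuple f) (hst : s.Le t)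
    {n : ℕ} {w : N}
    (hfree : ∀ s' : State U, s'.Le s → ∀ n' w', n ≤ n' → w' ∈ W n' → w ≤ w' →
      Succeeds br W c ε f s' n' w')
    (s' : State U) (hs' : s'.Le s) {m : ℕ} (hm : n ≤ m) {Y : Set N} (hY : Y.Finite)
    (hYW : ∀ y ∈ Y, y ∈ W m ∧ w ≤ y) :
    ∃ (b : State U) (F : Set N), b.Le s' ∧ F ⊆ W (b.lev 0) ∧ m ≤ b.lev 0 ∧
      (∀ y ∈ Y, ∃ x ∈ F, y ≤ x) ∧ (∀ x ∈ F, ∃ y ∈ Y, y ≤ x) ∧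
      ∀ x ∈ F, ∀ g, b.Tuple g → (∀ i, f i ≤ g i) → c (b.lev 0) g x = ε := by
  have step : ∃ b : State U, b.Le s' ∧ ∀ y ∈ Y, ∃ n' w', w' ∈ W n' ∧ y ≤ w' ∧
      Hom (fun m y => c m y (br n' w' m)) ε b f := by
    induction Y, hY using Set.Finite.induction_on with
    | empty => exact ⟨s', Le.refl _, fun y hy => hy.elim⟩
    | @insert y Y _ _ ih =>
      obtain ⟨b, hb, h⟩ := ih fun y hy => hYW y (Set.mem_insert_of_mem _ hy)
      have hy := hYW y (Set.mem_insert _ _)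
      obtain ⟨d, hd, n', w', -, hw', hle, hh⟩ := hfree b (hb.trans hs') m y hm hy.1 hy.2
      refine ⟨d, hd.trans hb, ?_⟩
      rintro z (rfl | hz)
      · exact ⟨n', w', hw', hle, hh⟩
      · obtain ⟨n', w', hw', hle, hh⟩ := h z hz
        exact ⟨n', w', hw', hle, hh.mono hU hd (hb.trans (hs'.trans hst)) hf⟩
  obtain ⟨b, hb, h⟩ := step
  choose! n' w' hw' hle hh using h
  obtain ⟨k, hk⟩ : ∃ k, ∀ y ∈ Y, n' y ≤ k := by
    obtain ⟨k, hk⟩ := (hY.image n').bddAbove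
    exact ⟨k, fun y hy => hk ⟨y, hy, rfl⟩⟩
  -- Beyond the index `max k m` every chosen branch has started and level `m` is passed, so `F` can
  -- be taken as the set of points where the branches meet one common level.
  have hlev : max k m ≤ b.lev (max k m) := b.lev_mono.le_apply
  have hle' := b.expand_le hU (max k m)
  have hl : (b.expand hU (max k m)).lev 0 = b.lev (max k m) := rfl
  have hny : ∀ y ∈ Y, n' y ≤ b.lev (max k m) := fun y hy =>
    (hk y hy).trans ((le_max_left _ _).trans hlev)
  refine ⟨b.expand hU (max k m), (fun y => br (n' y) (w' y) (b.lev (max k m))) '' Y,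
    hle'.trans hb, ?_, (le_max_right _ _).trans hlev, ?_, ?_, ?_⟩
  · rintro _ ⟨y, hy, rfl⟩
    exact (hbr _ _ (hw' y hy) _ (hny y hy)).1
  · intro y hy
    exact ⟨_, ⟨y, hy, rfl⟩, (hle y hy).trans (hbr _ _ (hw' y hy) _ (hny y hy)).2⟩
  · rintro _ ⟨y, hy, rfl⟩
    exact ⟨y, hy, (hle y hy).trans (hbr _ _ (hw' y hy) _ (hny y hy)).2⟩
  · rintro _ ⟨y, hy, rfl⟩ g hg hfg
    exact (hh y hy).mono hU hle' (hb.trans (hs'.trans hst)) hf g hg hfg 0 g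
      fun i => State.root _ i _ (hg i)

/-- Repeated domination builds all subtrees simultaneously: at each stage every immediate successor
of the current nodes, in the trees `U i` and in `W`, is extended into a configuration of colour `ε`.
-/
theorem exists_strong_of_free (hU : ∀ i, IsTree (U i)) (hW : IsTree W) (br : ℕ → N → ℕ → N)
    (hbr : ∀ n, ∀ w ∈ W n, ∀ m, n ≤ m → br n w m ∈ W m ∧ w ≤ br n w m)
    (c : ℕ → (ι → N) → N → C) (ε : C) {f : ι → N} {t s : State U} (hf : t.Tuple f) (hst : s.Le t)
    {n : ℕ} {w : N} (hw : w ∈ W n)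
    (hfree : ∀ s' : State U, s'.Le s → ∀ n' w', n ≤ n' → w' ∈ W n' → w ≤ w' →
      Succeeds br W c ε f s' n' w') :
    ∃ (φ : ℕ → ℕ) (S : ι → ℕ → Set N) (S' : ℕ → Set N), StrictMono φ ∧
      (∀ i, IsStrong φ (S i) (U i)) ∧ IsStrong φ S' W ∧ (∀ i, (S i 0).Nonempty) ∧
      (S' 0).Nonempty ∧ ∀ n x y, (∀ i, x i ∈ S i n) → y ∈ S' n → c (φ n) x y = ε := by
  let Good : State U × Set N → Prop := fun p => p.1.Le s ∧ n ≤ p.1.lev 0 ∧ p.2 ⊆ W (p.1.lev 0) ∧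
    (∀ x ∈ p.2, w ≤ x) ∧
    ∀ x ∈ p.2, ∀ g, p.1.Tuple g → (∀ i, f i ≤ g i) → c (p.1.lev 0) g x = ε
  have dom := exists_dominating hU br hbr c ε hf hst hfree
  obtain ⟨b, F, hb, hFW, hn, hF1, hF2, hF3⟩ := dom s (Le.refl s) le_rfl (Set.finite_singleton w)
    (by rintro y rfl; exact ⟨hw, le_rfl⟩)
  have hgood : Good (b, F) := ⟨hb, hn, hFW, fun x hx => by
    obtain ⟨y, rfl, hy⟩ := hF2 x hx; exact hy, hF3⟩
  have hnext : ∀ p : {p // Good p}, ∃ p' : {p // Good p}, p'.1.1.Le (p.1.1.expand hU 1) ∧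
      ∀ x ∈ p.1.2, ∀ y ∈ W (p.1.1.lev 0 + 1), x ≤ y → ∃ z ∈ p'.1.2, y ≤ z := by
    rintro ⟨⟨a, F⟩, ha, hn, hFW, hw, hc⟩
    have hfin : {y | y ∈ W (a.lev 0 + 1) ∧ ∃ x ∈ F, x ≤ y}.Finite :=
      (hW.finite _).subset fun y hy => hy.1
    -- Expanding by one level makes the state dominate the immediate successors of its nodes; the
    -- set to be dominated in `W` consists of the immediate successors of `F`.
    obtain ⟨b, F', hb, hFW', hn', hF1, hF2, hF3⟩ := dom (a.expand hU 1)
      ((a.expand_le hU 1).trans ha) (Nat.le_succ_of_le hn) hfin (by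
        rintro y ⟨hy, x, hx, hxy⟩
        exact ⟨hy, (hw x hx).trans hxy⟩)
    refine ⟨⟨(b, F'), hb.trans ((a.expand_le hU 1).trans ha),
      (Nat.le_succ_of_le hn).trans hn', hFW', fun x hx => ?_, hF3⟩, hb, fun x hx y hy hxy => ?_⟩
    · obtain ⟨y, ⟨-, z, hz, hzy⟩, hyx⟩ := hF2 x hx
      exact (hw z hz).trans (hzy.trans hyx)
    · exact hF1 y ⟨hy, x, hx, hxy⟩
  choose next hnext1 hnext2 using hnext
  let p : ℕ → {p // Good p} := fun k => Nat.rec ⟨(b, F), hgood⟩ (fun _ q => next q) k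
  have hp : ∀ k, p (k + 1) = next (p k) := fun k => rfl
  have hmono : StrictMono fun k => (p k).1.1.lev 0 := by
    refine strictMono_nat_of_lt_succ fun k => ?_
    obtain ⟨φ, -, hl, -⟩ := hnext1 (p k)
    have : (p (k + 1)).1.1.lev 0 = (p k).1.1.lev (1 + φ 0) := by
      rw [hp, hl]; rfl
    rw [this]
    exact (p k).1.1.lev_mono (by omega)
  refine ⟨fun k => (p k).1.1.lev 0, fun i k => {x | x ∈ (p k).1.1.J i ∧ f i ≤ x},
    fun k => (p k).1.2, hmono, fun i => ⟨hmono, ?_, ?_⟩, ⟨hmono, ?_, ?_⟩, fun i => ?_, ?_, ?_⟩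
  · exact fun k x hx => (p k).1.1.mem_level hx.1
  · rintro k x ⟨hx, hfx⟩ y hy hxy
    obtain ⟨z, hz, hyz⟩ := ((p k).1.1.strong i x hx).dom 0 x ((p k).1.1.root i x hx) y hy hxy
    obtain ⟨φ, -, -, h1, -⟩ := hnext1 (p k)
    obtain ⟨z', hz', hzz'⟩ := h1 i z ⟨x, hx, hz⟩
    exact ⟨z', ⟨hz', hfx.trans (hxy.trans (hyz.trans hzz'))⟩, hyz.trans hzz'⟩
  · exact fun k => (p k).2.2.2.1
  · exact fun k x hx y hy hxy => hnext2 (p k) x hx y hy hxy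
  · obtain ⟨g, hg, hfg⟩ := ((p 0).2.1.trans hst).exists_tuple hf
    exact ⟨g i, hg i, hfg i⟩
  · obtain ⟨x, hx, -⟩ := hF1 w rfl
    exact ⟨x, hx⟩
  · exact fun k x y hx hy => (p k).2.2.2.2.2 y hy x (fun i => (hx i).1) fun i => (hx i).2

/-- Somewhere, success is unavoidable. -/
def Free (br : ℕ → N → ℕ → N) (U : ι → ℕ → Set N) (W : ℕ → Set N) (c : ℕ → (ι → N) → N → C) :
    Prop :=
  ∃ (t s : State U) (f : ι → N) (ε : C) (n : ℕ) (w : N), t.Tuple f ∧ s.Le t ∧ w ∈ W n ∧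
    ∀ s' : State U, s'.Le s → ∀ n' w', n ≤ n' → w' ∈ W n' → w ≤ w' →
      Succeeds br W c ε f s' n' w'

/-- Without `Free`, each pair of a tuple and a colour can be made to fail by moving further up.
Failure is inherited upwards and there are finitely many pairs, so all of them fail at once. -/
theorem exists_stuck [Finite ι] [Finite C] (hHL : HasHL ι N) (hU : ∀ i, IsTree (U i))
    (br : ℕ → N → ℕ → N) (c : ℕ → (ι → N) → N → C) (hfree : ¬ Free br U W c) (t : State U)
    {n : ℕ} {w : N} (hw : w ∈ W n) :
    ∃ (s : State U) (n' : ℕ) (w' : N), s.Le t ∧ n ≤ n' ∧ w' ∈ W n' ∧ w ≤ w' ∧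
      Decided (fun m y => c m y (br n' w' m)) s ∧
      ∀ f, t.Tuple f → ∀ ε, ¬ Succeeds br W c ε f s n' w' := by
  have key : ∀ P : Set ((ι → N) × C), P.Finite → (∀ p ∈ P, t.Tuple p.1) →
      ∃ (s : State U) (n' : ℕ) (w' : N), s.Le t ∧ n ≤ n' ∧ w' ∈ W n' ∧ w ≤ w' ∧
        ∀ p ∈ P, ¬ Succeeds br W c p.2 p.1 s n' w' := by
    intro P hP hPt
    induction P, hP using Set.Finite.induction_on with
    | empty => exact ⟨t, n, w, Le.refl t, le_rfl, hw, le_rfl, fun p hp => hp.elim⟩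
    | @insert p P _ _ ih =>
      obtain ⟨s, n', w', hs, hn, hw', hle, h⟩ := ih fun q hq => hPt q (Set.mem_insert_of_mem _ hq)
      have : ¬ ∀ s' : State U, s'.Le s → ∀ m v, n' ≤ m → v ∈ W m → w' ≤ v →
          Succeeds br W c p.2 p.1 s' m v := fun hall =>
        hfree ⟨t, s, p.1, p.2, n', w', hPt p (Set.mem_insert _ _), hs, hw', hall⟩
      push Not at this
      obtain ⟨s', hs', m, v, hm, hv, hwv, hnot⟩ := this
      refine ⟨s', m, v, hs'.trans hs, hn.trans hm, hv, hle.trans hwv, ?_⟩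
      rintro q (rfl | hq)
      · exact hnot
      · exact fun hq' => h q hq (hq'.mono hs' hm hwv)
  obtain ⟨s, n', w', hs, hn, hw', hle, h⟩ := key ({f | t.Tuple f} ×ˢ Set.univ)
    (t.finite_tuples.prod Set.finite_univ) fun p hp => hp.1
  obtain ⟨s', hs', hd⟩ := exists_decided hHL hU (fun m y => c m y (br n' w' m)) s
  exact ⟨s', n', w', hs'.trans hs, hn, hw', hle, hd, fun f hf ε hε =>
    h (f, ε) ⟨hf, trivial⟩ (hε.mono hs' le_rfl le_rfl)⟩

/-- If success can always be prevented, iterate `exists_stuck`. The nodes of the resulting states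
form trees, on which the induction hypothesis finds strong subtrees homogeneous for the colours
along the current branches. Their first two levels then witness a success that was ruled out. -/
theorem free_of_hasHL [Finite ι] [Finite C] (hHL : HasHL ι N) (hU : ∀ i, IsTree (U i))
    (hU0 : ∀ i, (U i 0).Nonempty) (hW0 : (W 0).Nonempty)
    (br : ℕ → N → ℕ → N) (c : ℕ → (ι → N) → N → C) : Free br U W c := by
  by_contra hfree
  let Q := State U × {q : ℕ × N // q.2 ∈ W q.1}
  have hnext : ∀ q : Q, ∃ q' : Q, q'.1.Le q.1 ∧ q.2.1.1 ≤ q'.2.1.1 ∧ q.2.1.2 ≤ q'.2.1.2 ∧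
      Decided (fun m y => c m y (br q'.2.1.1 q'.2.1.2 m)) q'.1 ∧
      ∀ f, q.1.Tuple f → ∀ ε, ¬ Succeeds br W c ε f q'.1 q'.2.1.1 q'.2.1.2 := by
    rintro ⟨t, ⟨n, w⟩, hw⟩
    obtain ⟨s, n', w', hs, hn, hw', hle, hd, h⟩ := exists_stuck hHL hU br c hfree t hw
    exact ⟨⟨s, ⟨n', w'⟩, hw'⟩, hs, hn, hle, hd, h⟩
  choose next hle hn hw hdec hstuck using hnext
  obtain ⟨w0, hw0⟩ := hW0
  obtain ⟨a, f, hf⟩ := exists_state hU0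
  let q : ℕ → Q := fun k => Nat.rec (next ⟨a, ⟨0, w0⟩, hw0⟩) (fun _ q => next q) k
  have hq : ∀ k, q (k + 1) = next (q k) := fun k => rfl
  have hmono : ∀ k l, k ≤ l → (q l).1.Le (q k).1 ∧ (q k).2.1.1 ≤ (q l).2.1.1 ∧
      (q k).2.1.2 ≤ (q l).2.1.2 := by
    intro k l h
    induction l, h using Nat.le_induction with
    | base => exact ⟨Le.refl _, le_rfl, le_rfl⟩
    | succ l _ ih =>
      exact ⟨(hle (q l)).trans ih.1, ih.2.1.trans (hn (q l)), ih.2.2.trans (hw (q l))⟩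
  have hdecq : ∀ k, Decided (fun m y => c m y (br (q k).2.1.1 (q k).2.1.2 m)) (q k).1 := by
    rintro (_ | k)
    · exact hdec _
    · exact hdec _
  have hT : ∀ i, IsTree fun k => (q k).1.J i := fun i =>
    { finite := fun k => (q k).1.finite i
      ext := fun k s hs => by
        obtain ⟨φ, -, -, h1, -⟩ := hle (q k)
        exact h1 i s hs
      unique := fun k s hs s' hs' z hz hz' => (q k).1.eq_of_le hU hs hs' hz hz' }
  obtain ⟨g0, hg0, -⟩ := (hle ⟨a, ⟨0, w0⟩, hw0⟩).exists_tuple hf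
  obtain ⟨ψ, S, ε, hψ, hS, hS0, hε⟩ := hHL C (fun i k => (q k).1.J i) hT (fun i => ⟨g0 i, hg0 i⟩)
    fun k y => c ((q k).1.lev 0) y (br (q k).2.1.1 (q k).2.1.2 ((q k).1.lev 0))
  choose f0 hf0 using hS0
  have hf0' : (q (ψ 0)).1.Tuple f0 := fun i => (hS i).mem 0 (hf0 i)
  have hlt : ψ 0 + 1 ≤ ψ 1 := hψ Nat.zero_lt_one
  obtain ⟨hle1, hn1, hw1⟩ := hmono _ _ hlt
  -- Above `f0` only nodes of the homogeneous subtree are kept. They still dominate the state with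
  -- index `ψ 0 + 1`, and since the state with index `ψ 1` is decided along its branch, all tuples
  -- above `f0` have colour `ε`.
  let t := (q (ψ 1)).1.restrict (fun i => {x | x ∈ (q (ψ 1)).1.J i ∧ (f0 i ≤ x → x ∈ S i 1)})
    fun i x hx => hx.1
  refine hstuck (q (ψ 0)) f0 hf0' ε ⟨t, ?_, (q (ψ 1)).2.1.1, (q (ψ 1)).2.1.2, hn1,
    (q (ψ 1)).2.2, hw1, ?_⟩
  · obtain ⟨φ, hφ, hl, h1, h2⟩ := hle1
    refine ⟨φ, hφ, hl, fun i x hx => ?_, fun i x hx => h2 i x hx.1⟩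
    by_cases hfx : f0 i ≤ x
    · obtain ⟨y, hy, hxy⟩ := (hS i).dom 0 (f0 i) (hf0 i) x hx hfx
      exact ⟨y, ⟨(hS i).mem 1 hy, fun _ => hy⟩, hxy⟩
    · obtain ⟨y, hy, hxy⟩ := h1 i x hx
      refine ⟨y, ⟨hy, fun h => (hfx ?_).elim⟩, hxy⟩
      exact (hle (q (ψ 0))).le_of_le hU (hf0' i) hx h hxy
  · intro g hg hfg k y hy
    have h1 := hdecq (ψ 1) g (fun i => (hg i).1) k y hy
    exact h1.trans (hε 1 g fun i => (hg i).2 (hfg i))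

end State

open State

variable {N : Type} [Preorder N]

/-- With no trees the colouring only depends on the level, and some colour occurs on infinitely many
levels. -/
theorem hasHL_of_isEmpty (ι : Type) [IsEmpty ι] : HasHL ι N := by
  intro C _ U hU hU0 c
  obtain ⟨ε, hε⟩ := Finite.exists_infinite_fiber fun n => c n isEmptyElim
  have hinf : {n | c n isEmptyElim = ε}.Infinite := Set.infinite_coe_iff.1 hε
  refine ⟨Nat.nth fun n => c n isEmptyElim = ε, isEmptyElim, ε, Nat.nth_strictMono hinf,
    isEmptyElim, isEmptyElim, fun n x _ => ?_⟩
  rw [Subsingleton.elim x isEmptyElim]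
  exact Nat.nth_mem_of_infinite hinf n

theorem HasHL.of_equiv {ι κ : Type} (e : ι ≃ κ) (h : HasHL ι N) : HasHL κ N := by
  intro C _ U hU hU0 c
  obtain ⟨φ, S, ε, hφ, hS, hS0, hε⟩ := h C (fun i => U (e i)) (fun i => hU _) (fun i => hU0 _)
    fun n x => c n (x ∘ e.symm)
  refine ⟨φ, fun k => S (e.symm k), ε, hφ, fun k => ?_, fun k => hS0 _, fun n x hx => ?_⟩
  · simpa using hS (e.symm k)
  · have := hε n (x ∘ e) fun i => by simpa using hx (e i)
    simpa [Function.comp_assoc] using this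

theorem HasHL.option {ι : Type} [Finite ι] (h : HasHL ι N) : HasHL (Option ι) N := by
  intro C _ U hU hU0 c
  have hW := hU none
  -- Only the value at each level `m` above `w` matters: the points of a "branch" need not be
  -- comparable with one another.
  have : ∀ n w m, ∃ x, w ∈ U none n → n ≤ m → x ∈ U none m ∧ w ≤ x := by
    intro n w m
    by_cases hw : w ∈ U none n ∧ n ≤ m
    · obtain ⟨x, hx, hwx⟩ := hW.exists_above hw.2 hw.1
      exact ⟨x, fun _ _ => ⟨hx, hwx⟩⟩
    · exact ⟨w, fun h h' => (hw ⟨h, h'⟩).elim⟩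
  choose br hbr using this
  have hbr' : ∀ n, ∀ w ∈ U none n, ∀ m, n ≤ m → br n w m ∈ U none m ∧ w ≤ br n w m :=
    fun n w hw m hm => hbr n w m hw hm
  obtain ⟨t, s, f, ε, n, w, hf, hst, hw, hfree⟩ := free_of_hasHL (W := U none) h
    (fun i => hU (some i)) (fun i => hU0 (some i)) (hU0 none) br
    fun m y z => c m fun o => o.elim z y
  obtain ⟨φ, S, S', hφ, hS, hS', hS0, hS0', hε⟩ := exists_strong_of_free (fun i => hU (some i))
    hW br hbr' _ ε hf hst hw hfree
  refine ⟨φ, fun o => o.elim S' S, ε, hφ, ?_, ?_, fun n x hx => ?_⟩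
  · rintro (_ | i)
    · exact hS'
    · exact hS i
  · rintro (_ | i)
    · exact hS0'
    · exact hS0 i
  · rw [← hε n (fun i => x (some i)) (x none) (fun i => hx (some i)) (hx none)]
    congr 1
    ext (_ | i) <;> rfl

theorem hasHL (ι : Type) [Finite ι] : HasHL ι N := by
  induction ι using Finite.induction_empty_option with
  | of_equiv e h => exact h.of_equiv e
  | h_empty => exact hasHL_of_isEmpty _
  | h_option h => exact h.option

end HalpernLauchli

/-! ### Strong maps of the binary tree and of the tree of triangular arrays -/

namespace StrongTree

/-- A list of rows (newest first) is valid if the `r`-th row has length `r`. -/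
def Valid : List (List Bool) → Prop
  | [] => True
  | a :: t => a.length = t.length ∧ Valid t

theorem suffix_eq_of_length_eq {γ : Type} {x y z : List γ} (hx : x <:+ z) (hy : y <:+ z)
    (h : x.length = y.length) : x = y :=
  (List.suffix_of_suffix_length_le hx hy h.le).eq_of_length h

theorem Valid.of_suffix {x y : List (List Bool)} (h : x <:+ y) (hy : Valid y) : Valid x := by
  induction y with
  | nil => rw [List.suffix_nil.1 h]; trivial
  | cons a t ih =>
    rcases List.suffix_cons_iff.1 h with rfl | h
    · exact hy
    · exact ih h hy.2

/-- A strong map of the binary tree and of the tree of valid lists of rows. -/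
structure StrongMap where
  lev : ℕ → ℕ
  B : List Bool → List Bool
  T : List (List Bool) → List (List Bool)
  length_B : ∀ s, (B s).length = lev s.length
  length_T : ∀ t, Valid t → (T t).length = lev t.length
  valid_T : ∀ t, Valid t → Valid (T t)
  B_cons : ∀ b s, b :: B s <:+ B (b :: s)
  -- The appended row is moved by `B`. By validity `a` and `t` have equal length, hence so do `B a`
  -- and `T t`, and the extension is again valid.
  T_cons : ∀ a t, Valid (a :: t) → B a :: T t <:+ T (a :: t)

namespace StrongMap

variable (f g : StrongMap)

/-- The immediate successor of the image of the predecessor of `s` that is below `f.B s`. -/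
def preB : List Bool → List Bool
  | [] => []
  | b :: s => b :: f.B s

/-- The immediate successor of the image of the predecessor of `t` that is below `f.T t`. -/
def preT : List (List Bool) → List (List Bool)
  | [] => []
  | a :: t => f.B a :: f.T t

theorem preB_suffix (s : List Bool) : f.preB s <:+ f.B s := by
  cases s with
  | nil => exact List.nil_suffix
  | cons b s => exact f.B_cons b s

theorem preT_suffix {t : List (List Bool)} (ht : Valid t) : f.preT t <:+ f.T t := by
  cases t with
  | nil => exact List.nil_suffix
  | cons b s => exact f.T_cons b s ht

theorem lev_lt_succ (n : ℕ) : f.lev n < f.lev (n + 1) := by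
  have h := (f.B_cons false (List.replicate n false)).length_le
  simpa [f.length_B] using h

theorem lev_strictMono : StrictMono f.lev := strictMono_nat_of_lt_succ f.lev_lt_succ

theorem B_mono {s t : List Bool} (h : s <:+ t) : f.B s <:+ f.B t := by
  induction t with
  | nil => rw [List.suffix_nil.1 h]
  | cons b t ih =>
    rcases List.suffix_cons_iff.1 h with rfl | h
    · exact List.suffix_rfl
    · exact (ih h).trans ((List.suffix_cons _ _).trans (f.B_cons b t))

theorem T_mono {s t : List (List Bool)} (ht : Valid t) (h : s <:+ t) : f.T s <:+ f.T t := by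
  induction t with
  | nil => rw [List.suffix_nil.1 h]
  | cons b t ih =>
    rcases List.suffix_cons_iff.1 h with rfl | h
    · exact List.suffix_rfl
    · exact (ih ht.2 h).trans ((List.suffix_cons _ _).trans (f.T_cons b t ht))

theorem B_injective {s t : List Bool} (hl : s.length = t.length) (h : f.B s = f.B t) : s = t := by
  induction s generalizing t with
  | nil => exact (List.length_eq_zero_iff.1 hl.symm).symm
  | cons b s ih =>
    cases t with
    | nil => simp at hl
    | cons b' t =>
      have hl' : s.length = t.length := by simpa using hl
      have := suffix_eq_of_length_eq (f.B_cons b s) (h ▸ f.B_cons b' t)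
        (by simp [f.length_B, hl'])
      rw [List.cons.injEq] at this
      rw [this.1, ih hl' this.2]

theorem T_injective {s t : List (List Bool)} (hs : Valid s) (ht : Valid t)
    (hl : s.length = t.length) (h : f.T s = f.T t) : s = t := by
  induction s generalizing t with
  | nil => exact (List.length_eq_zero_iff.1 hl.symm).symm
  | cons b s ih =>
    cases t with
    | nil => simp at hl
    | cons b' t =>
      have hl' : s.length = t.length := by simpa using hl
      have := suffix_eq_of_length_eq (f.T_cons b s hs) (h ▸ f.T_cons b' t ht)
        (by simp [f.length_T, hl', hs.2, ht.2])
      rw [List.cons.injEq] at this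
      rw [f.B_injective (by rw [hs.1, ht.1, hl']) this.1, ih hs.2 ht.2 hl' this.2]

/-- The identity map. -/
def id : StrongMap where
  lev n := n
  B s := s
  T t := t
  length_B _ := rfl
  length_T _ _ := rfl
  valid_T _ h := h
  B_cons _ _ := List.suffix_rfl
  T_cons _ _ _ := List.suffix_rfl

theorem valid_cons {a : List Bool} {t : List (List Bool)} (h : Valid (a :: t)) :
    Valid (f.B a :: f.T t) :=
  ⟨by rw [f.length_B, f.length_T t h.2, h.1], f.valid_T t h.2⟩

/-- The composition of strong maps. -/
def comp : StrongMap where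
  lev n := f.lev (g.lev n)
  B s := f.B (g.B s)
  T t := f.T (g.T t)
  length_B s := by rw [f.length_B, g.length_B]
  length_T t h := by rw [f.length_T _ (g.valid_T t h), g.length_T t h]
  valid_T t h := f.valid_T _ (g.valid_T t h)
  B_cons b s := (f.B_cons b _).trans (f.B_mono (g.B_cons b s))
  T_cons a t h := (f.T_cons _ _ (g.valid_cons h)).trans (f.T_mono (g.valid_T _ h) (g.T_cons a t h))

/-- The two maps agree on all levels below `h`. -/
structure AgreeBelow (h : ℕ) : Prop where
  B : ∀ s, s.length < h → f.B s = g.B s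
  T : ∀ t, Valid t → t.length < h → f.T t = g.T t

variable {f g}

theorem AgreeBelow.refl (h : ℕ) (f : StrongMap) : AgreeBelow f f h :=
  ⟨fun _ _ => rfl, fun _ _ _ => rfl⟩

theorem AgreeBelow.symm {h : ℕ} (H : AgreeBelow f g h) : AgreeBelow g f h :=
  ⟨fun s hs => (H.B s hs).symm, fun t ht hl => (H.T t ht hl).symm⟩

theorem AgreeBelow.trans {h : ℕ} {k : StrongMap} (H : AgreeBelow f g h) (H' : AgreeBelow g k h) :
    AgreeBelow f k h :=
  ⟨fun s hs => (H.B s hs).trans (H'.B s hs), fun t ht hl => (H.T t ht hl).trans (H'.T t ht hl)⟩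

theorem AgreeBelow.mono {h h' : ℕ} (H : AgreeBelow f g h) (hh : h' ≤ h) : AgreeBelow f g h' :=
  ⟨fun s hs => H.B s (hs.trans_le hh), fun t ht hl => H.T t ht (hl.trans_le hh)⟩

theorem AgreeBelow.lev {h : ℕ} (H : AgreeBelow f g h) {n : ℕ} (hn : n < h) :
    f.lev n = g.lev n := by
  have := congrArg List.length (H.B (List.replicate n false) (by simpa using hn))
  simpa [StrongMap.length_B] using this

theorem AgreeBelow.comp_left {h : ℕ} (H : AgreeBelow f g h) (k : StrongMap) :
    AgreeBelow (k.comp f) (k.comp g) h :=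
  ⟨fun s hs => congrArg k.B (H.B s hs), fun t ht hl => congrArg k.T (H.T t ht hl)⟩

theorem AgreeBelow.comp_right {h m : ℕ} (H : AgreeBelow f g m) (k : StrongMap)
    (hk : ∀ n < h, k.lev n < m) : AgreeBelow (f.comp k) (g.comp k) h :=
  ⟨fun s hs => H.B _ (by rw [k.length_B]; exact hk _ hs),
    fun t ht hl => H.T _ (k.valid_T t ht) (by rw [k.length_T t ht]; exact hk _ hl)⟩

theorem AgreeBelow.preB {h : ℕ} (H : AgreeBelow f g h) {s : List Bool} (hs : s.length ≤ h) :
    f.preB s = g.preB s := by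
  cases s with
  | nil => rfl
  | cons b s => simp only [StrongMap.preB, H.B s hs]

theorem AgreeBelow.preT {h : ℕ} (H : AgreeBelow f g h) {t : List (List Bool)} (ht : Valid t)
    (hs : t.length ≤ h) : f.preT t = g.preT t := by
  cases t with
  | nil => rfl
  | cons a t =>
    simp only [StrongMap.preT, H.T t ht.2 hs, H.B a (ht.1 ▸ hs)]

/-- The map is the identity on all levels below `N`. -/
def IdBelow (N : ℕ) (f : StrongMap) : Prop := AgreeBelow f id N

theorem IdBelow.comp {N : ℕ} (hf : IdBelow N f) (hg : IdBelow N g) : IdBelow N (f.comp g) :=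
  (hg.comp_left f).trans hf

theorem IdBelow.preB {N : ℕ} (hf : IdBelow N f) {s : List Bool} (hs : s.length ≤ N) :
    f.preB s = s := by
  rw [AgreeBelow.preB hf hs]; cases s <;> rfl

theorem IdBelow.preT {N : ℕ} (hf : IdBelow N f) {t : List (List Bool)} (ht : Valid t)
    (hs : t.length ≤ N) : f.preT t = t := by
  rw [AgreeBelow.preT hf ht hs]; cases t <;> rfl

/-- The colouring only depends on the levels below `h`. -/
def Local {C : Type} (h : ℕ) (χ : StrongMap → C) : Prop :=
  ∀ f g : StrongMap, AgreeBelow f g h → χ f = χ g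

end StrongMap

/-! ### Strong maps built from prescribed levels and candidate values -/

section Build

/-- Add `k` zero rows. -/
def zeroRows (z : List (List Bool)) : ℕ → List (List Bool)
  | 0 => z
  | k + 1 => List.replicate (zeroRows z k).length false :: zeroRows z k

theorem suffix_zeroRows (z : List (List Bool)) (k : ℕ) : z <:+ zeroRows z k := by
  induction k with
  | zero => exact List.suffix_rfl
  | succ k ih => exact ih.trans (List.suffix_cons _ _)

theorem length_zeroRows (z : List (List Bool)) (k : ℕ) : (zeroRows z k).length = z.length + k := by
  induction k with
  | zero => rfl
  | succ k ih => simp [zeroRows, ih, Nat.add_assoc]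

theorem valid_zeroRows {z : List (List Bool)} (hz : Valid z) (k : ℕ) : Valid (zeroRows z k) := by
  induction k with
  | zero => exact hz
  | succ k ih => exact ⟨by simp, ih⟩

open Classical in
/-- Extend `z` to length `n`, to the candidate `x` if possible. -/
noncomputable def pickB (n : ℕ) (x z : List Bool) : List Bool :=
  if z <:+ x ∧ x.length = n then x else List.replicate (n - z.length) false ++ z

open Classical in
/-- Extend `z` to length `n`, to the candidate `x` if possible. -/
noncomputable def pickT (n : ℕ) (x z : List (List Bool)) : List (List Bool) :=
  if z <:+ x ∧ Valid x ∧ x.length = n then x else zeroRows z (n - z.length)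

variable {n : ℕ}

theorem pickB_eq {x z : List Bool} (h : z <:+ x) (hl : x.length = n) : pickB n x z = x :=
  if_pos ⟨h, hl⟩

theorem pickT_eq {x z : List (List Bool)} (h : z <:+ x) (hv : Valid x) (hl : x.length = n) :
    pickT n x z = x :=
  if_pos ⟨h, hv, hl⟩

theorem suffix_pickB (x z : List Bool) : z <:+ pickB n x z := by
  rw [pickB]
  split_ifs with h
  · exact h.1
  · exact List.suffix_append _ _

theorem suffix_pickT (x z : List (List Bool)) : z <:+ pickT n x z := by
  rw [pickT]
  split_ifs with h
  · exact h.1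
  · exact suffix_zeroRows _ _

theorem length_pickB {x z : List Bool} (hz : z.length ≤ n) : (pickB n x z).length = n := by
  rw [pickB]
  split_ifs with h
  · exact h.2
  · simp [hz]

theorem length_pickT {x z : List (List Bool)} (hz : z.length ≤ n) : (pickT n x z).length = n := by
  rw [pickT]
  split_ifs with h
  · exact h.2.2
  · rw [length_zeroRows]; omega

theorem valid_pickT {x z : List (List Bool)} (hz : Valid z) : Valid (pickT n x z) := by
  rw [pickT]
  split_ifs with h
  · exact h.2.1
  · exact valid_zeroRows hz _

theorem pickB_eq_self {x z : List Bool} (hz : z.length = n) : pickB n x z = z :=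
  ((suffix_pickB x z).eq_of_length (by rw [length_pickB hz.le, hz])).symm

theorem pickT_eq_self {x z : List (List Bool)} (hz : z.length = n) : pickT n x z = z :=
  ((suffix_pickT x z).eq_of_length (by rw [length_pickT hz.le, hz])).symm

variable (lev : ℕ → ℕ) (cB : List Bool → List Bool → List Bool)
  (cT : List (List Bool) → List (List Bool) → List (List Bool))

/-- The map of the binary tree with given levels and candidates. -/
noncomputable def buildB : List Bool → List Bool
  | [] => pickB (lev 0) (cB [] []) []
  | b :: s => pickB (lev (s.length + 1)) (cB (b :: s) (b :: buildB s)) (b :: buildB s)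

/-- The map of the tree of valid lists with given levels and candidates. -/
noncomputable def buildT : List (List Bool) → List (List Bool)
  | [] => pickT (lev 0) (cT [] []) []
  | a :: t => pickT (lev (t.length + 1)) (cT (a :: t) (buildB lev cB a :: buildT t))
      (buildB lev cB a :: buildT t)

variable {lev}

theorem length_buildB (hlev : StrictMono lev) (s : List Bool) :
    (buildB lev cB s).length = lev s.length := by
  induction s with
  | nil => exact length_pickB (Nat.zero_le _)
  | cons b s ih =>
    refine length_pickB ?_
    rw [List.length_cons, ih]
    exact hlev (Nat.lt_succ_self _)

theorem length_buildT (hlev : StrictMono lev) (t : List (List Bool)) :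
    (buildT lev cB cT t).length = lev t.length := by
  induction t with
  | nil => exact length_pickT (Nat.zero_le _)
  | cons b s ih =>
    refine length_pickT ?_
    rw [List.length_cons, ih]
    exact hlev (Nat.lt_succ_self _)

theorem valid_buildT (hlev : StrictMono lev) (t : List (List Bool)) (ht : Valid t) :
    Valid (buildT lev cB cT t) := by
  induction t with
  | nil => exact valid_pickT trivial
  | cons b s ih =>
    refine valid_pickT ⟨?_, ih ht.2⟩
    rw [length_buildT _ _ hlev, length_buildB _ hlev, ht.1]

/-- The strong map with given levels and candidates. -/
noncomputable def build (hlev : StrictMono lev) : StrongMap where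
  lev := lev
  B := buildB lev cB
  T := buildT lev cB cT
  length_B := length_buildB cB hlev
  length_T t _ := length_buildT cB cT hlev t
  valid_T := valid_buildT cB cT hlev
  B_cons _ _ := suffix_pickB _ _
  T_cons _ _ _ := suffix_pickT _ _

theorem build_B (hlev : StrictMono lev) (s : List Bool) :
    (build cB cT hlev).B s =
      pickB (lev s.length) (cB s ((build cB cT hlev).preB s)) ((build cB cT hlev).preB s) := by
  cases s <;> rfl

theorem build_T (hlev : StrictMono lev) (t : List (List Bool)) :
    (build cB cT hlev).T t =
      pickT (lev t.length) (cT t ((build cB cT hlev).preT t)) ((build cB cT hlev).preT t) := by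
  cases t <;> rfl

/-- Where the levels are those of the identity, the forced initial segment already has full length
and leaves no room for a candidate. -/
theorem build_idBelow (hlev : StrictMono lev) {N : ℕ} (hN : ∀ n < N, lev n = n) :
    (build cB cT hlev).IdBelow N := by
  have hB : ∀ s : List Bool, s.length < N → (build cB cT hlev).B s = s := by
    intro s
    induction s with
    | nil =>
      intro hs
      rw [build_B]
      exact pickB_eq_self (hN 0 hs).symm
    | cons b s ih =>
      intro hs
      have : (build cB cT hlev).preB (b :: s) = b :: s :=
        congrArg (b :: ·) (ih ((Nat.lt_succ_self _).trans hs))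
      rw [build_B, this]
      exact pickB_eq_self (hN _ hs).symm
  refine ⟨hB, fun t ht => ?_⟩
  induction t with
  | nil =>
    intro hs
    rw [build_T]
    exact pickT_eq_self (hN 0 hs).symm
  | cons a t ih =>
    intro hs
    have hs' : t.length < N := (Nat.lt_succ_self _).trans hs
    have : (build cB cT hlev).preT (a :: t) = a :: t :=
      congrArg₂ _ (hB a (by rw [ht.1]; exact hs')) (ih ht.2 hs')
    rw [build_T, this]
    exact pickT_eq_self (hN _ hs).symm

end Build

theorem finite_valid (n : ℕ) : {t | Valid t ∧ t.length = n}.Finite := by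
  induction n with
  | zero =>
    refine (Set.finite_singleton []).subset fun t ht => List.length_eq_zero_iff.1 ht.2
  | succ n ih =>
    refine ((List.finite_length_eq Bool n).image2 List.cons ih).subset ?_
    rintro (_ | ⟨a, t⟩) ⟨hv, hl⟩
    · simp at hl
    · have hl' : t.length = n := by simpa using hl
      exact ⟨a, hv.1.trans hl', t, ⟨hv.2, hl'⟩, rfl⟩

end StrongTree

/-! ### The one-step pigeonhole principle -/

namespace StrongTree

open HalpernLauchli StrongMap

/-- A node of the binary tree together with a list of rows. -/
structure Node where
  b : List Bool
  t : List (List Bool)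

/-- A common type for both trees, as `HasHL` asks for: nodes of one tree get the empty list as their
other component. -/
instance : Preorder Node where
  le x y := x.b <:+ y.b ∧ x.t <:+ y.t
  le_refl _ := ⟨List.suffix_rfl, List.suffix_rfl⟩
  le_trans _ _ _ h h' := ⟨h.1.trans h'.1, h.2.trans h'.2⟩

/-- The nodes of length `N` of the two trees. -/
abbrev LevelIndex (N : ℕ) : Type :=
  {s : List Bool // s.length = N} ⊕ {t : List (List Bool) // Valid t ∧ t.length = N}

instance (N : ℕ) : Finite (LevelIndex N) :=
  haveI : Finite {s : List Bool // s.length = N} := (List.finite_length_eq Bool N).to_subtype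
  haveI : Finite {t : List (List Bool) // Valid t ∧ t.length = N} := (finite_valid N).to_subtype
  inferInstance

/-- The trees above the nodes of length `N`. -/
def levelTree (N : ℕ) : LevelIndex N → ℕ → Set Node
  | .inl s, n => {p | s.1 <:+ p.b ∧ p.b.length = N + n ∧ p.t = []}
  | .inr t, n => {p | t.1 <:+ p.t ∧ Valid p.t ∧ p.t.length = N + n ∧ p.b = []}

theorem isTree_levelTree (N : ℕ) (i : LevelIndex N) : IsTree (levelTree N i) := by
  rcases i with s | t
  · refine ⟨fun n => ?_, ?_, ?_⟩
    · refine ((List.finite_length_eq Bool (N + n)).image fun x => (⟨x, []⟩ : Node)).subset ?_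
      rintro ⟨x, y⟩ ⟨-, hl, rfl⟩
      exact ⟨x, hl, rfl⟩
    · rintro n ⟨x, y⟩ ⟨hs, hl, rfl⟩
      exact ⟨⟨false :: x, []⟩, ⟨hs.trans (List.suffix_cons _ _),
        by simp only [List.length_cons]; exact congrArg (· + 1) hl, rfl⟩,
        List.suffix_cons _ _, List.suffix_rfl⟩
    · rintro n ⟨x, y⟩ ⟨-, hl, rfl⟩ ⟨x', y'⟩ ⟨-, hl', rfl⟩ z ⟨hz, -⟩ ⟨hz', -⟩
      exact congrArg (Node.mk · []) (suffix_eq_of_length_eq hz hz' (hl.trans hl'.symm))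
  · refine ⟨fun n => ?_, ?_, ?_⟩
    · refine ((finite_valid (N + n)).image fun x => (⟨[], x⟩ : Node)).subset ?_
      rintro ⟨x, y⟩ ⟨-, hv, hl, rfl⟩
      exact ⟨y, ⟨hv, hl⟩, rfl⟩
    · rintro n ⟨x, y⟩ ⟨hs, hv, hl, rfl⟩
      exact ⟨⟨[], List.replicate y.length false :: y⟩, ⟨hs.trans (List.suffix_cons _ _),
        ⟨by simp, hv⟩, by simp only [List.length_cons]; exact congrArg (· + 1) hl, rfl⟩,
        List.suffix_rfl, List.suffix_cons _ _⟩
    · rintro n ⟨x, y⟩ ⟨-, -, hl, rfl⟩ ⟨x', y'⟩ ⟨-, -, hl', rfl⟩ z ⟨-, hz⟩ ⟨-, hz'⟩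
      exact congrArg (Node.mk []) (suffix_eq_of_length_eq hz hz' (hl.trans hl'.symm))

theorem levelTree_nonempty (N : ℕ) (i : LevelIndex N) : (levelTree N i 0).Nonempty := by
  rcases i with s | t
  · exact ⟨⟨s.1, []⟩, List.suffix_rfl, s.2, rfl⟩
  · exact ⟨⟨[], t.1⟩, List.suffix_rfl, t.2.1, t.2.2, rfl⟩

/-- The map is the identity below `N`, and is given on level `N` by `X`. -/
structure HasLevel (N : ℕ) (X : LevelIndex N → Node) (g : StrongMap) : Prop where
  id : IdBelow N g
  B : ∀ s, g.B s.1 = (X (.inl s)).b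
  T : ∀ t, g.T t.1 = (X (.inr t)).t

theorem HasLevel.agreeBelow {N : ℕ} {X : LevelIndex N → Node} {f g : StrongMap}
    (hf : HasLevel N X f) (hg : HasLevel N X g) : AgreeBelow f g (N + 1) := by
  refine ⟨fun s hs => ?_, fun t ht hl => ?_⟩
  · rcases Nat.lt_succ_iff_lt_or_eq.1 hs with h | h
    · exact (hf.id.trans hg.id.symm).B s h
    · exact (hf.B ⟨s, h⟩).trans (hg.B ⟨s, h⟩).symm
  · rcases Nat.lt_succ_iff_lt_or_eq.1 hl with h | h
    · exact (hf.id.trans hg.id.symm).T t ht h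
    · exact (hf.T ⟨t, ht, h⟩).trans (hg.T ⟨t, ht, h⟩).symm

/-- A vector of strong subtrees above the nodes of length `N` is the range of a strong map. -/
theorem exists_map_into {N : ℕ} {φ : ℕ → ℕ} {S : LevelIndex N → ℕ → Set Node} (hφ : StrictMono φ)
    (hS : ∀ i, IsStrong φ (S i) (levelTree N i)) (hS0 : ∀ i, (S i 0).Nonempty) :
    ∃ e : StrongMap, IdBelow N e ∧ (∀ n, e.lev (N + n) = N + φ n) ∧
      (∀ s x n, x.length = N + n → s.1 <:+ x → ⟨e.B x, []⟩ ∈ S (.inl s) n) ∧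
      (∀ t x n, Valid x → x.length = N + n → t.1 <:+ x → ⟨[], e.T x⟩ ∈ S (.inr t) n) := by
  classical
  let lev : ℕ → ℕ := fun n => if n < N then n else N + φ (n - N)
  have hlev : StrictMono lev := by
    refine strictMono_nat_of_lt_succ fun n => ?_
    rcases lt_trichotomy (n + 1) N with h | h | h
    · simp only [lev, if_pos h, if_pos (Nat.lt_of_succ_lt h)]; omega
    · have h1 : n < N := by omega
      simp only [lev, if_pos h1, h, lt_irrefl, if_false]; omega
    · have h1 : ¬ n < N := by omega
      have h2 : ¬ n + 1 < N := by omega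
      simp only [lev, if_neg h1, if_neg h2]
      exact Nat.add_lt_add_left (hφ (by omega)) N
  have hlevN : ∀ n, lev (N + n) = N + φ n := fun n => by
    simp only [lev, if_neg (Nat.not_lt.2 (Nat.le_add_right N n)), Nat.add_sub_cancel_left]
  -- Any node of the given subtree above the forced segment serves as candidate; the default `z` is
  -- never relevant at levels from `N` on, because the subtrees dominate.
  let cB : List Bool → List Bool → List Bool := fun x z =>
    if h : ∃ p, ∃ s, s.1 <:+ x ∧ p ∈ S (.inl s) (x.length - N) ∧ z <:+ p.b then h.choose.b else z
  let cT : List (List Bool) → List (List Bool) → List (List Bool) := fun x z =>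
    if h : ∃ p, ∃ t, t.1 <:+ x ∧ p ∈ S (.inr t) (x.length - N) ∧ z <:+ p.t then h.choose.t else z
  let e := build cB cT hlev
  have hid : IdBelow N e := build_idBelow cB cT hlev fun n hn => if_pos hn
  have hB : ∀ s x n, x.length = N + n → s.1 <:+ x →
      (∃ p ∈ S (.inl s) n, e.preB x <:+ p.b) → ⟨e.B x, []⟩ ∈ S (.inl s) n := by
    rintro s x n hx hs ⟨p, hp, hpx⟩
    have hn : x.length - N = n := by omega
    have hex : ∃ p, ∃ s, s.1 <:+ x ∧ p ∈ S (.inl s) (x.length - N) ∧ e.preB x <:+ p.b :=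
      ⟨p, s, hs, hn.symm ▸ hp, hpx⟩
    obtain ⟨q, ⟨s', hs', hp', hpx'⟩, hc⟩ : ∃ q, (∃ s, s.1 <:+ x ∧ q ∈ S (.inl s) (x.length - N) ∧
        e.preB x <:+ q.b) ∧ cB x (e.preB x) = q.b :=
      ⟨hex.choose, hex.choose_spec, dif_pos hex⟩
    obtain rfl : s' = s :=
      Subtype.ext (suffix_eq_of_length_eq hs' hs (s'.2.trans s.2.symm))
    rw [hn] at hp'
    have hU := (hS _).mem n hp'
    have : e.B x = q.b := by
      rw [build_B]
      rw [hc]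
      refine pickB_eq hpx' ?_
      rw [hU.2.1, hx, hlevN]
    rw [this]
    convert hp'
    exact hU.2.2.symm
  have hT : ∀ t x n, x.length = N + n → t.1 <:+ x →
      (∃ p ∈ S (.inr t) n, e.preT x <:+ p.t) → ⟨[], e.T x⟩ ∈ S (.inr t) n := by
    rintro s x n hx hs ⟨p, hp, hpx⟩
    have hn : x.length - N = n := by omega
    have hex : ∃ p, ∃ t, t.1 <:+ x ∧ p ∈ S (.inr t) (x.length - N) ∧ e.preT x <:+ p.t :=
      ⟨p, s, hs, hn.symm ▸ hp, hpx⟩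
    obtain ⟨q, ⟨s', hs', hp', hpx'⟩, hc⟩ : ∃ q, (∃ t, t.1 <:+ x ∧ q ∈ S (.inr t) (x.length - N) ∧
        e.preT x <:+ q.t) ∧ cT x (e.preT x) = q.t :=
      ⟨hex.choose, hex.choose_spec, dif_pos hex⟩
    obtain rfl : s' = s :=
      Subtype.ext (suffix_eq_of_length_eq hs' hs (s'.2.2.trans s.2.2.symm))
    rw [hn] at hp'
    have hU := (hS _).mem n hp'
    have : e.T x = q.t := by
      rw [build_T]
      rw [hc]
      refine pickT_eq hpx' hU.2.1 ?_
      rw [hU.2.2.1, hx, hlevN]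
    rw [this]
    convert hp'
    exact hU.2.2.2.symm
  refine ⟨e, hid, hlevN, fun s x n => ?_, fun t x n => ?_⟩
  · induction n generalizing x with
    | zero =>
      intro hx hs
      have hxs := hs.eq_of_length (s.2.trans hx.symm)
      refine hB s x 0 hx hs ?_
      obtain ⟨p, hp⟩ := hS0 (.inl s)
      exact ⟨p, hp, by rw [hid.preB hx.le, ← hxs]; exact ((hS _).mem 0 hp).1⟩
    | succ n ih =>
      intro hx hs
      cases x with
      | nil => simp only [List.length_nil] at hx; omega
      | cons b x =>
        have hx' : x.length = N + n := by simp only [List.length_cons] at hx; omega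
        have hs' : s.1 <:+ x := by
          rcases List.suffix_cons_iff.1 hs with h | h
          · have := s.2; rw [h] at this; simp only [List.length_cons] at this; omega
          · exact h
        have hmem := ih x hx' hs'
        have hU := (hS _).mem n hmem
        obtain ⟨p, hp, hle⟩ := (hS (.inl s)).dom n _ hmem ⟨b :: e.B x, []⟩
          ⟨hU.1.trans (List.suffix_cons _ _),
            by simp only [List.length_cons]; exact congrArg (· + 1) hU.2.1, rfl⟩
          ⟨List.suffix_cons _ _, List.suffix_rfl⟩
        exact hB s _ _ hx hs ⟨p, hp, hle.1⟩
  · induction n generalizing x with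
    | zero =>
      intro hv hx hs
      have hxs := hs.eq_of_length (t.2.2.trans hx.symm)
      refine hT t x 0 hx hs ?_
      obtain ⟨p, hp⟩ := hS0 (.inr t)
      exact ⟨p, hp, by rw [hid.preT hv hx.le, ← hxs]; exact ((hS _).mem 0 hp).1⟩
    | succ n ih =>
      intro hv hx hs
      cases x with
      | nil => simp only [List.length_nil] at hx; omega
      | cons b x =>
        have hx' : x.length = N + n := by simp only [List.length_cons] at hx; omega
        have hs' : t.1 <:+ x := by
          rcases List.suffix_cons_iff.1 hs with h | h
          · have := t.2.2; rw [h] at this; simp only [List.length_cons] at this; omega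
          · exact h
        have hmem := ih x hv.2 hx' hs'
        have hU := (hS _).mem n hmem
        -- Domination covers every immediate successor in the ambient tree, so the row `e.B b` fixed
        -- earlier by the binary part is no obstruction.
        obtain ⟨p, hp, hle⟩ := (hS (.inr t)).dom n _ hmem ⟨[], e.B b :: e.T x⟩
          ⟨hU.1.trans (List.suffix_cons _ _), e.valid_cons hv,
            by simp only [List.length_cons]; exact congrArg (· + 1) hU.2.2.1, rfl⟩
          ⟨List.suffix_rfl, List.suffix_cons _ _⟩
        exact hT t _ _ hx hs ⟨p, hp, hle.2⟩

/-- One-step pigeonhole principle: maps that are the identity below `N` can be made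
monochromatic for colourings of their first non-trivial level. -/
theorem exists_const_of_local {C : Type} [Finite C] {N : ℕ} {χ : StrongMap → C}
    (hχ : Local (N + 1) χ) :
    ∃ e : StrongMap, IdBelow N e ∧ ∃ ε, ∀ x, IdBelow N x → χ (e.comp x) = ε := by
  classical
  -- A map that is the identity below `N` is determined up to level `N` by its values there, and
  -- these form a tuple of nodes. Tuples that come from no map get an arbitrary colour.
  let c : ℕ → (LevelIndex N → Node) → C := fun _ X =>
    if h : ∃ g, HasLevel N X g then χ h.choose else χ StrongMap.id
  have hc : ∀ n X g, HasLevel N X g → c n X = χ g := by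
    intro n X g hg
    have hex : ∃ g, HasLevel N X g := ⟨g, hg⟩
    simp only [c, dif_pos hex]
    exact hχ _ _ (hex.choose_spec.agreeBelow hg)
  obtain ⟨φ, S, ε, hφ, hS, hS0, hε⟩ := hasHL (LevelIndex N) C (levelTree N) (isTree_levelTree N)
    (levelTree_nonempty N) c
  obtain ⟨e, he, -, hB, hT⟩ := exists_map_into hφ hS hS0
  refine ⟨e, he, ε, fun x hx => ?_⟩
  let X : LevelIndex N → Node := Sum.elim (fun s => ⟨e.B (x.B s.1), []⟩) fun t => ⟨[], e.T (x.T t.1)⟩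
  have hX : HasLevel N X (e.comp x) := ⟨he.comp hx, fun _ => rfl, fun _ => rfl⟩
  have hle : N ≤ x.lev N := x.lev_strictMono.le_apply
  obtain ⟨n, hn⟩ := Nat.exists_eq_add_of_le hle
  rw [← hc (φ n) X _ hX]
  refine hε n X ?_
  rintro (s | t)
  · refine hB s _ n (by rw [x.length_B, s.2, hn]) ?_
    have := x.preB_suffix s.1
    rwa [hx.preB s.2.le] at this
  · refine hT t _ n (x.valid_T _ t.2.1) (by rw [x.length_T _ t.2.1, t.2.2, hn]) ?_
    have := x.preT_suffix t.2.1
    rwa [hx.preT t.2.1 t.2.2.le] at this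

end StrongTree

/-! ### Fusion and the Ramsey theorem for strong maps -/

namespace StrongTree

open StrongMap

namespace StrongMap

/-- The least possible value of level `h` of a map that agrees with `g` below `h`. -/
def nextLevel (g : StrongMap) : ℕ → ℕ
  | 0 => 0
  | h + 1 => g.lev h + 1

theorem nextLevel_le (g : StrongMap) (h : ℕ) : g.nextLevel h ≤ g.lev h := by
  cases h with
  | zero => exact Nat.zero_le _
  | succ h => exact g.lev_lt_succ h

theorem lev_lt_nextLevel (g : StrongMap) {h n : ℕ} (hn : n < h) : g.lev n < g.nextLevel h := by
  cases h with
  | zero => omega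
  | succ h => exact Nat.lt_succ_of_le (g.lev_strictMono.monotone (Nat.lt_succ_iff.1 hn))

theorem length_preB (g : StrongMap) (s : List Bool) :
    (g.preB s).length = g.nextLevel s.length := by
  cases s with
  | nil => rfl
  | cons b s => simp [preB, nextLevel, g.length_B]

theorem length_preT (g : StrongMap) {t : List (List Bool)} (ht : Valid t) :
    (g.preT t).length = g.nextLevel t.length := by
  cases t with
  | nil => rfl
  | cons b s => simp [preT, nextLevel, g.length_T _ ht.2]

theorem AgreeBelow.nextLevel {f g : StrongMap} {h : ℕ} (H : AgreeBelow f g h) :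
    f.nextLevel h = g.nextLevel h := by
  cases h with
  | zero => rfl
  | succ h => exact congrArg (· + 1) (H.lev (Nat.lt_succ_self h))

/-- The map that agrees with `g` below `h` and makes no detour at level `h`. -/
theorem exists_base (g : StrongMap) (h : ℕ) :
    ∃ g₀ : StrongMap, AgreeBelow g₀ g h ∧ g₀.lev h = g.nextLevel h ∧
      (∀ s, s.length = h → g₀.B s = g.preB s) ∧
      ∀ t, Valid t → t.length = h → g₀.T t = g.preT t := by
  let lev : ℕ → ℕ := fun n => if n < h then g.lev n else g.nextLevel h + (n - h)
  have hlev : StrictMono lev := by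
    refine strictMono_nat_of_lt_succ fun n => ?_
    rcases lt_trichotomy (n + 1) h with h' | h' | h'
    · simp only [lev, if_pos h', if_pos (Nat.lt_of_succ_lt h')]; exact g.lev_lt_succ n
    · have h1 : n < h := by omega
      have := g.lev_lt_nextLevel h1
      simp only [lev, if_pos h1, h', lt_irrefl, if_false]; omega
    · have h1 : ¬ n < h := by omega
      have h2 : ¬ n + 1 < h := by omega
      simp only [lev, if_neg h1, if_neg h2]
      omega
  have hlevh : lev h = g.nextLevel h := by simp [lev]
  let g₀ := build (fun s _ => g.B s) (fun t _ => g.T t) hlev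
  have hB : ∀ s : List Bool, s.length < h → g₀.B s = g.B s := by
    intro s
    induction s with
    | nil =>
      intro hs
      rw [build_B]
      exact pickB_eq List.nil_suffix (by rw [g.length_B]; exact (if_pos hs).symm)
    | cons b s ih =>
      intro hs
      have : g₀.preB (b :: s) = g.preB (b :: s) :=
        congrArg (b :: ·) (ih ((Nat.lt_succ_self _).trans hs))
      rw [build_B]
      refine pickB_eq (this ▸ g.preB_suffix _) (by rw [g.length_B]; exact (if_pos hs).symm)
  have hT : ∀ t, Valid t → t.length < h → g₀.T t = g.T t := by
    intro t ht
    induction t with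
    | nil =>
      intro hs
      rw [build_T]
      exact pickT_eq List.nil_suffix (g.valid_T _ ht)
        (by rw [g.length_T _ ht]; exact (if_pos hs).symm)
    | cons a t ih =>
      intro hs
      have hs' : t.length < h := (Nat.lt_succ_self _).trans hs
      have : g₀.preT (a :: t) = g.preT (a :: t) :=
        congrArg₂ List.cons (hB a (by rw [ht.1]; exact hs')) (ih ht.2 hs')
      rw [build_T]
      exact pickT_eq (this ▸ g.preT_suffix ht) (g.valid_T _ ht)
        (by rw [g.length_T _ ht]; exact (if_pos hs).symm)
  have hag : AgreeBelow g₀ g h := ⟨hB, hT⟩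
  refine ⟨g₀, hag, hlevh, fun s hs => ?_, fun t ht hs => ?_⟩
  · rw [build_B, ← hag.preB hs.le]
    refine pickB_eq_self ?_
    rw [hag.preB hs.le, length_preB, hs, hlevh]
  · rw [build_T, ← hag.preT ht hs.le]
    refine pickT_eq_self ?_
    rw [hag.preT ht hs.le, length_preT _ ht, hs, hlevh]

/-- Every map factors, up to level `h`, through the base of its restriction below `h`. -/
theorem exists_factor (g : StrongMap) (h : ℕ) :
    ∃ g₀ : StrongMap, ∀ g', AgreeBelow g' g h →
      ∃ x, IdBelow (g₀.lev h) x ∧ AgreeBelow g' (x.comp g₀) (h + 1) := by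
  classical
  obtain ⟨g₀, hag, hlev₀, hB₀, hT₀⟩ := exists_base g h
  refine ⟨g₀, fun g' hg' => ?_⟩
  set N := g₀.lev h with hN
  have hNg' : N ≤ g'.lev h := by
    rw [hlev₀, ← hg'.nextLevel]; exact g'.nextLevel_le h
  let lev : ℕ → ℕ := fun n => if n < N then n else g'.lev h + (n - N)
  have hlev : StrictMono lev := by
    refine strictMono_nat_of_lt_succ fun n => ?_
    simp only [lev]
    split_ifs <;> omega
  have hlevN : lev N = g'.lev h := by simp [lev]
  -- A node on level `N` in the image of `g₀` is sent where `g'` sends its preimage, which is unique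
  -- by injectivity on a level.
  let cB : List Bool → List Bool → List Bool := fun y z =>
    if H : ∃ s, s.length = h ∧ g₀.B s = y then g'.B H.choose else z
  let cT : List (List Bool) → List (List Bool) → List (List Bool) := fun y z =>
    if H : ∃ t, Valid t ∧ t.length = h ∧ g₀.T t = y then g'.T H.choose else z
  let x := build cB cT hlev
  have hid : IdBelow N x := build_idBelow cB cT hlev fun n hn => if_pos hn
  have hag' : AgreeBelow g' (x.comp g₀) h := by
    refine (hg'.trans hag.symm).trans ?_
    exact (AgreeBelow.comp_right hid g₀ fun n hn => g₀.lev_strictMono hn).symm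
  refine ⟨x, hid, fun s hs => ?_, fun t ht hs => ?_⟩
  · rcases Nat.lt_succ_iff_lt_or_eq.1 hs with hs | hs
    · exact hag'.B s hs
    · have hex : ∃ s', s'.length = h ∧ g₀.B s' = g₀.B s := ⟨s, hs, rfl⟩
      have hch : hex.choose = s :=
        g₀.B_injective (hex.choose_spec.1.trans hs.symm) hex.choose_spec.2
      have hc : ∀ z, cB (g₀.B s) z = g'.B s := fun z => by
        simp only [cB, dif_pos hex, hch]
      have hl : (g₀.B s).length = N := by rw [g₀.length_B, hs]
      change g'.B s = x.B (g₀.B s)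
      rw [build_B, hc, hl]
      refine (pickB_eq ?_ (by rw [hlevN, g'.length_B, hs])).symm
      change x.preB (g₀.B s) <:+ _
      rw [hid.preB hl.le, hB₀ s hs, ← hg'.preB hs.le]
      exact g'.preB_suffix s
  · rcases Nat.lt_succ_iff_lt_or_eq.1 hs with hs | hs
    · exact hag'.T t ht hs
    · have hex : ∃ t', Valid t' ∧ t'.length = h ∧ g₀.T t' = g₀.T t := ⟨t, ht, hs, rfl⟩
      have hch : hex.choose = t :=
        g₀.T_injective hex.choose_spec.1 ht (hex.choose_spec.2.1.trans hs.symm)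
          hex.choose_spec.2.2
      have hc : ∀ z, cT (g₀.T t) z = g'.T t := fun z => by
        simp only [cT, dif_pos hex, hch]
      have hl : (g₀.T t).length = N := by rw [g₀.length_T _ ht, hs]
      change g'.T t = x.T (g₀.T t)
      rw [build_T, hc, hl]
      refine (pickT_eq ?_ (g'.valid_T _ ht) (by rw [hlevN, g'.length_T _ ht, hs])).symm
      change x.preT (g₀.T t) <:+ _
      rw [hid.preT (g₀.valid_T _ ht) hl.le, hT₀ t ht hs, ← hg'.preT ht hs.le]
      exact g'.preT_suffix ht

/-- The values of the map on the levels up to `h`. -/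
def values (h : ℕ) (g : StrongMap) :
    ({s : List Bool // s.length < h + 1} → List Bool) ×
      ({t : List (List Bool) // Valid t ∧ t.length < h + 1} → List (List Bool)) :=
  (fun s => g.B s.1, fun t => g.T t.1)

theorem agreeBelow_of_values_eq {h : ℕ} {f g : StrongMap} (H : values h f = values h g) :
    AgreeBelow f g (h + 1) := by
  rw [values, values, Prod.mk.injEq] at H
  exact ⟨fun s hs => congrFun H.1 ⟨s, hs⟩, fun t ht hs => congrFun H.2 ⟨t, ht, hs⟩⟩

end StrongMap

theorem finite_valid_lt (n : ℕ) : {t | Valid t ∧ t.length < n}.Finite := by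
  refine ((Set.finite_lt_nat n).biUnion fun m _ => finite_valid m).subset fun t ht => ?_
  exact Set.mem_biUnion (x := t.length) ht.2 ⟨ht.1, rfl⟩

/-- Arguments of length at most `h` are sent to lists of length at most `N`. -/
theorem StrongMap.finite_values (h N : ℕ) : {v | ∃ g, g.lev h = N ∧ values h g = v}.Finite := by
  have : Finite {s : List Bool // s.length < h + 1} := (List.finite_length_lt Bool _).to_subtype
  have : Finite {t : List (List Bool) // Valid t ∧ t.length < h + 1} :=
    (finite_valid_lt _).to_subtype
  refine Set.Finite.subset (Set.Finite.prod
    (Set.Finite.pi' (ι := {s : List Bool // s.length < h + 1})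
      fun _ => List.finite_length_lt Bool (N + 1))
    (Set.Finite.pi' (ι := {t : List (List Bool) // Valid t ∧ t.length < h + 1})
      fun _ => finite_valid_lt (N + 1))) ?_
  rintro _ ⟨g, rfl, rfl⟩
  refine ⟨fun s => ?_, fun t => ⟨g.valid_T _ t.2.1, ?_⟩⟩
  · change (g.B s.1).length < _
    rw [g.length_B, Nat.lt_succ_iff]
    exact g.lev_strictMono.monotone (Nat.lt_succ_iff.1 s.2)
  · change (g.T t.1).length < _
    rw [g.length_T _ t.2.1, Nat.lt_succ_iff]
    exact g.lev_strictMono.monotone (Nat.lt_succ_iff.1 t.2.2)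

/-- One step of the fusion: the colour of `f ∘ e ∘ x ∘ r` does not depend on `x` for all maps `r`
whose level `h` is `N`. -/
theorem exists_fusion_step {C : Type} [Finite C] {h : ℕ} {χ : StrongMap → C}
    (hχ : Local (h + 1) χ) (N : ℕ) (f : StrongMap) :
    ∃ e : StrongMap, IdBelow N e ∧ ∀ r : StrongMap, r.lev h = N → ∀ x y, IdBelow N x → IdBelow N y →
      χ (f.comp (e.comp (x.comp r))) = χ (f.comp (e.comp (y.comp r))) := by
  let K := {v | ∃ g, g.lev h = N ∧ values h g = v}
  have : Finite K := (finite_values h N).to_subtype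
  choose rep hrep hval using fun v : K => v.2
  -- All restrictions of maps with level `h` equal to `N` are handled together by colouring `x` with
  -- the vector of the resulting colours.
  have hloc : Local (N + 1) fun x (v : K) => χ (f.comp (x.comp (rep v))) := by
    intro x y hxy
    funext v
    refine hχ _ _ ((hxy.comp_right (rep v) fun n hn => ?_).comp_left f)
    rw [Nat.lt_succ_iff, ← hrep v]
    exact (rep v).lev_strictMono.monotone (Nat.lt_succ_iff.1 hn)
  obtain ⟨e, he, ε, hε⟩ := exists_const_of_local hloc
  refine ⟨e, he, fun r hr x y hx hy => ?_⟩
  let v : K := ⟨values h r, r, hr, rfl⟩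
  have hag : AgreeBelow r (rep v) (h + 1) := agreeBelow_of_values_eq (hval v).symm
  have key : ∀ x, IdBelow N x → χ (f.comp (e.comp (x.comp r))) = ε v := by
    intro x hx
    rw [← hε x hx]
    exact hχ _ _ (((hag.comp_left x).comp_left e).comp_left f)
  rw [key x hx, key y hy]

/-- The limit of a fusion sequence. -/
theorem exists_limit {f e : ℕ → StrongMap} (he : ∀ n, IdBelow n (e n))
    (hf : ∀ n, f (n + 1) = (f n).comp (e n)) :
    ∃ F : StrongMap, ∀ n, AgreeBelow F (f n) n := by
  have hmono : ∀ n m, n ≤ m → AgreeBelow (f m) (f n) n := by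
    intro n m h
    induction m, h using Nat.le_induction with
    | base => exact AgreeBelow.refl _ _
    | succ m hm ih =>
      refine AgreeBelow.trans ?_ ih
      rw [hf]
      exact (AgreeBelow.comp_left (he m) (f m)).mono hm
  -- The index is one more than the length, since `f n` is final only strictly below level `n`.
  refine ⟨{ lev := fun n => (f (n + 1)).lev n
            B := fun s => (f (s.length + 1)).B s
            T := fun t => (f (t.length + 1)).T t
            length_B := fun s => (f _).length_B s
            length_T := fun t => (f _).length_T t
            valid_T := fun t => (f _).valid_T t
            B_cons := fun b s => ?_
            T_cons := fun a t ht => ?_ }, fun n => ⟨fun s hs => ?_, fun t ht hs => ?_⟩⟩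
  · rw [← (hmono (s.length + 1) ((b :: s).length + 1) (by simp)).B s (by simp)]
    exact (f _).B_cons b s
  · rw [← (hmono (t.length + 1) ((a :: t).length + 1) (by simp)).T t ht.2 (by simp), ht.1,
      ← (hmono (t.length + 1) ((a :: t).length + 1) (by simp)).B a (by simp [ht.1])]
    exact (f _).T_cons a t ht
  · exact ((hmono _ n hs).B s (Nat.lt_succ_self _)).symm
  · exact ((hmono _ n hs).T t ht (Nat.lt_succ_self _)).symm

/-- Maps agreeing with `g` below `h` are, up to level `h`, of the form `x.comp g₀` with a common
`g₀` and `x` the identity below `g₀.lev h`. Stage `g₀.lev h` of the fusion removed the dependence on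
`x`; the later stages are absorbed into `x`. -/
theorem exists_local_comp {C : Type} [Finite C] {h : ℕ} {χ : StrongMap → C}
    (hχ : Local (h + 1) χ) : ∃ F : StrongMap, Local h fun g => χ (F.comp g) := by
  choose e he hc using fun N f => exists_fusion_step hχ N f
  let f : ℕ → StrongMap := fun n => Nat.rec StrongMap.id (fun N f => f.comp (e N f)) n
  have hf : ∀ n, f (n + 1) = (f n).comp (e n (f n)) := fun n => rfl
  obtain ⟨F, hF⟩ := exists_limit (e := fun n => e n (f n)) (fun n => he _ _) hf
  have hR : ∀ n m, n ≤ m → ∃ R, IdBelow n R ∧ f m = (f n).comp R := by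
    intro n m hnm
    induction m, hnm using Nat.le_induction with
    | base => exact ⟨StrongMap.id, AgreeBelow.refl _ _, rfl⟩
    | succ m hm ih =>
      obtain ⟨R, hR, hfm⟩ := ih
      refine ⟨R.comp (e m (f m)), hR.comp ((he m (f m)).mono hm), ?_⟩
      rw [hf, hfm]; rfl
  refine ⟨F, fun g' g hg => ?_⟩
  obtain ⟨g₀, hg₀⟩ := exists_factor g h
  have key : ∀ k, AgreeBelow k g h → ∃ x, IdBelow (g₀.lev h) x ∧
      χ (F.comp k) = χ ((f (g₀.lev h)).comp ((e (g₀.lev h) (f (g₀.lev h))).comp (x.comp g₀))) := by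
    intro k hk
    obtain ⟨x, hx, hkx⟩ := hg₀ k hk
    obtain ⟨R, hR, hfR⟩ := hR (g₀.lev h + 1) (max (k.lev h) (g₀.lev h) + 1) (by omega)
    refine ⟨R.comp x, IdBelow.comp (hR.mono (Nat.le_succ _)) hx, ?_⟩
    have h1 : AgreeBelow (F.comp k) ((f (max (k.lev h) (g₀.lev h) + 1)).comp k) (h + 1) := by
      refine (hF (max (k.lev h) (g₀.lev h) + 1)).comp_right k fun n hn => ?_
      have := k.lev_strictMono.monotone (Nat.lt_succ_iff.1 hn)
      omega
    rw [hχ _ _ h1, hfR, hf]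
    exact hχ _ _ (hkx.comp_left _)
  obtain ⟨x, hx, hx'⟩ := key g' hg
  obtain ⟨y, hy, hy'⟩ := key g (AgreeBelow.refl _ _)
  simp only [hx', hy']
  exact hc _ _ g₀ rfl x y hx hy

/-- The Ramsey theorem for initial segments of strong maps. -/
theorem exists_const_comp {C : Type} [Finite C] (h : ℕ) {χ : StrongMap → C} (hχ : Local h χ) :
    ∃ (f : StrongMap) (ε : C), ∀ g, χ (f.comp g) = ε := by
  induction h generalizing χ with
  | zero =>
    exact ⟨StrongMap.id, χ StrongMap.id, fun g => hχ _ _ ⟨fun s hs => by simp at hs,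
      fun t _ hs => by simp at hs⟩⟩
  | succ h ih =>
    obtain ⟨F, hF⟩ := exists_local_comp hχ
    obtain ⟨f, ε, hε⟩ := ih hF
    exact ⟨F.comp f, ε, hε⟩

end StrongTree

/-! ### Capturing branches by a strong map -/

namespace StrongTree

open StrongMap

section Initial

variable {γ : Type}

/-- The first `n` terms of a sequence, newest first. -/
def initial (σ : ℕ → γ) : ℕ → List γ
  | 0 => []
  | n + 1 => σ n :: initial σ n

@[simp]
theorem length_initial (σ : ℕ → γ) (n : ℕ) : (initial σ n).length = n := by
  induction n with
  | zero => rfl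
  | succ n ih => simp [initial, ih]

theorem initial_suffix (σ : ℕ → γ) {m n : ℕ} (h : m ≤ n) : initial σ m <:+ initial σ n := by
  induction n, h using Nat.le_induction with
  | base => exact List.suffix_rfl
  | succ n _ ih => exact ih.trans (List.suffix_cons _ _)

theorem initial_eq_iff {σ τ : ℕ → γ} {n : ℕ} :
    initial σ n = initial τ n ↔ ∀ k < n, σ k = τ k := by
  induction n with
  | zero => simp [initial]
  | succ n ih =>
    simp only [initial, List.cons.injEq, ih, Nat.lt_succ_iff_lt_or_eq]
    constructor
    · rintro ⟨h, h'⟩ k (hk | rfl)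
      · exact h' k hk
      · exact h
    · exact fun h => ⟨h n (Or.inr rfl), fun k hk => h k (Or.inl hk)⟩

theorem valid_initial {M : ℕ → List Bool} (hM : ∀ n, (M n).length = n) (n : ℕ) :
    Valid (initial M n) := by
  induction n with
  | zero => trivial
  | succ n ih => exact ⟨by simp [hM], ih⟩

/-- The first index at which two sequences differ. -/
noncomputable def firstDiff (σ τ : ℕ → γ) : ℕ := sInf {n | σ n ≠ τ n}

/-- If first differences only occur at the levels of `g`, then a sequence is determined up to the
next level by what is forced. -/
theorem initial_lev_eq (g : StrongMap) {P : Set (ℕ → γ)}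
    (hP : ∀ σ ∈ P, ∀ τ ∈ P, σ ≠ τ → ∃ j, g.lev j = firstDiff σ τ) {σ τ : ℕ → γ} (hσ : σ ∈ P)
    (hτ : τ ∈ P) {j : ℕ} (h : initial σ (g.nextLevel j) <:+ initial τ (g.lev j)) :
    initial σ (g.lev j) = initial τ (g.lev j) := by
  have h1 : initial σ (g.nextLevel j) = initial τ (g.nextLevel j) :=
    suffix_eq_of_length_eq h (initial_suffix τ (g.nextLevel_le j)) (by simp)
  rw [initial_eq_iff] at h1 ⊢
  intro k hk
  by_contra hne
  have hστ : σ ≠ τ := fun h => hne (congrFun h k)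
  obtain ⟨i, hi⟩ := hP σ hσ τ hτ hστ
  have hmem : σ (firstDiff σ τ) ≠ τ (firstDiff σ τ) :=
    Nat.sInf_mem (s := {n | σ n ≠ τ n}) ⟨k, hne⟩
  have hle : firstDiff σ τ ≤ k := Nat.sInf_le hne
  -- The first difference would sit on a level before the `j`-th, but up to `nextLevel j` the
  -- sequences agree.
  have hij : i < j := g.lev_strictMono.lt_iff_lt.1 (by omega)
  exact hmem (h1 _ (hi ▸ g.lev_lt_nextLevel hij))

end Initial

/-- A strong map with given levels that captures given branches of the binary tree and of the
tree of valid lists. -/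
theorem exists_capture {lev : ℕ → ℕ} (hlev : StrictMono lev) {P : Set (ℕ → Bool)}
    (hP : ∀ σ ∈ P, ∀ τ ∈ P, σ ≠ τ → ∃ j, lev j = firstDiff σ τ) {Q : Set (ℕ → List Bool)}
    (hQ : ∀ M ∈ Q, ∀ n, (M n).length = n)
    (hQ' : ∀ M ∈ Q, ∀ M' ∈ Q, M ≠ M' → ∃ j, lev j = firstDiff M M') {J : ℕ}
    (hJ : ∀ M ∈ Q, ∀ j < J, ∃ σ ∈ P, M (lev j) = initial σ (lev j)) :
    ∃ u : StrongMap, ∀ M ∈ Q, ∀ j ≤ J, ∃ t, Valid t ∧ t.length = j ∧ u.T t = initial M (lev j) := by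
  classical
  -- Which compatible branch is picked does not matter: by `initial_lev_eq` all of them agree up to
  -- the next level.
  let cB : List Bool → List Bool → List Bool := fun s z =>
    if h : ∃ x, (∃ σ ∈ P, x = initial σ (lev s.length)) ∧ z <:+ x then h.choose else z
  let cT : List (List Bool) → List (List Bool) → List (List Bool) := fun t z =>
    if h : ∃ x, (∃ M ∈ Q, x = initial M (lev t.length)) ∧ z <:+ x then h.choose else z
  let u := build cB cT hlev
  have hB : ∀ s, ∀ σ ∈ P, u.preB s = initial σ (u.nextLevel s.length) →
      u.B s = initial σ (lev s.length) := by
    intro s σ hσ hs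
    have hex : ∃ x, (∃ σ ∈ P, x = initial σ (lev s.length)) ∧ u.preB s <:+ x :=
      ⟨_, ⟨σ, hσ, rfl⟩, hs ▸ initial_suffix σ (u.nextLevel_le _)⟩
    obtain ⟨⟨τ, hτ, hx⟩, hsx⟩ := hex.choose_spec
    have hc : cB s (u.preB s) = initial σ (lev s.length) := by
      simp only [cB, dif_pos hex]
      rw [hx]
      rw [hx, hs] at hsx
      exact (initial_lev_eq u hP hσ hτ hsx).symm
    rw [build_B]
    refine (congrArg (fun x => pickB _ x _) hc).trans (pickB_eq ?_ (by simp))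
    exact hs ▸ initial_suffix σ (u.nextLevel_le _)
  have hT : ∀ t, ∀ M ∈ Q, u.preT t = initial M (u.nextLevel t.length) →
      u.T t = initial M (lev t.length) := by
    intro t M hM hs
    have hex : ∃ x, (∃ M ∈ Q, x = initial M (lev t.length)) ∧ u.preT t <:+ x :=
      ⟨_, ⟨M, hM, rfl⟩, hs ▸ initial_suffix M (u.nextLevel_le _)⟩
    obtain ⟨⟨τ, hτ, hx⟩, hsx⟩ := hex.choose_spec
    have hc : cT t (u.preT t) = initial M (lev t.length) := by
      simp only [cT, dif_pos hex]
      rw [hx]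
      rw [hx, hs] at hsx
      exact (initial_lev_eq u hQ' hM hτ hsx).symm
    rw [build_T]
    refine (congrArg (fun x => pickT _ x _) hc).trans
      (pickT_eq ?_ (valid_initial (hQ M hM) _) (by simp))
    exact hs ▸ initial_suffix M (u.nextLevel_le _)
  have hB' : ∀ j, ∀ σ ∈ P, ∃ s, s.length = j ∧ u.B s = initial σ (lev j) := by
    intro j σ hσ
    induction j with
    | zero => exact ⟨[], rfl, hB [] σ hσ rfl⟩
    | succ j ih =>
      obtain ⟨s, rfl, hs⟩ := ih
      exact ⟨σ (lev s.length) :: s, rfl, hB _ σ hσ (congrArg (_ :: ·) hs)⟩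
  refine ⟨u, fun M hM j => ?_⟩
  induction j with
  | zero => exact fun _ => ⟨[], trivial, rfl, hT [] M hM rfl⟩
  | succ j ih =>
    intro hj
    obtain ⟨t, ht, rfl, htM⟩ := ih (Nat.le_of_succ_le hj)
    obtain ⟨σ, hσ, hrow⟩ := hJ M hM t.length hj
    obtain ⟨a, ha, haB⟩ := hB' t.length σ hσ
    exact ⟨a :: t, ⟨ha, ht⟩, rfl, hT _ M hM (congrArg₂ List.cons (haB.trans hrow.symm) htM)⟩

/-- A finite set of numbers is an initial segment of the levels of a strictly monotone map. -/
theorem exists_strictMono_enum (L : Finset ℕ) :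
    ∃ lev : ℕ → ℕ, StrictMono lev ∧ (∀ n ∈ L, ∃ j < L.card, lev j = n) ∧
      ∀ j < L.card, lev j ∈ L := by
  let e := L.orderEmbOfFin rfl
  have hsup : ∀ i, e i ≤ L.sup id := fun i => Finset.le_sup (f := id) (L.orderEmbOfFin_mem rfl i)
  refine ⟨fun j => if h : j < L.card then e ⟨j, h⟩ else L.sup id + 1 + j, fun i j hij => ?_,
    fun n hn => ?_, fun j hj => ?_⟩
  · by_cases hj : j < L.card
    · simp only [dif_pos hj, dif_pos (hij.trans hj)]
      exact e.strictMono hij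
    · simp only [dif_neg hj]
      split_ifs with hi
      · have := hsup ⟨i, hi⟩; omega
      · omega
  · have : n ∈ Set.range e := by rw [Finset.range_orderEmbOfFin]; exact hn
    obtain ⟨i, hi⟩ := this
    exact ⟨i, i.2, by simp only [dif_pos i.2]; exact hi⟩
  · simp only [dif_pos hj]
    exact L.orderEmbOfFin_mem rfl _

/-! ### Padded codes and envelopes of bounded size -/

section Coding

variable (E : ℕ → ℕ → ℕ → Bool)

/-- Row `r` of the code of `i`, as an infinite sequence; the even rows are zero. -/
def rowSeq (i r l : ℕ) : Bool := r % 2 == 1 && E (l / 2) (r / 2) i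

/-- The rows of the code of `i`. -/
def codeRows (i r : ℕ) : List Bool := initial (rowSeq E i r) r

/-- The code of `i`. -/
def code (i : ℕ) : List (List Bool) := initial (codeRows E i) (2 * i + 1)

theorem length_codeRows (i r : ℕ) : (codeRows E i r).length = r := length_initial _ _

theorem valid_code (i : ℕ) : Valid (code E i) := valid_initial (length_codeRows E i) _

theorem length_code (i : ℕ) : (code E i).length = 2 * i + 1 := length_initial _ _

theorem rowSeq_even (i : ℕ) {r : ℕ} (hr : r % 2 = 0) : rowSeq E i r = rowSeq E i 0 := by
  funext l
  simp [rowSeq, hr]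

/-- Columns `2m` and `2m + 1` of a row coincide. Equal rows have first difference `0` by the
convention for `sInf ∅`, which is even too. -/
theorem firstDiff_rowSeq_even (i r i' r' : ℕ) :
    firstDiff (rowSeq E i r) (rowSeq E i' r') % 2 = 0 := by
  by_contra h
  set d := firstDiff (rowSeq E i r) (rowSeq E i' r') with hd
  have hne : {n | rowSeq E i r n ≠ rowSeq E i' r' n}.Nonempty := by
    by_contra hemp
    rw [Set.not_nonempty_iff_eq_empty] at hemp
    rw [hd, firstDiff, hemp, Nat.sInf_empty] at h
    exact h rfl
  have hmem : rowSeq E i r d ≠ rowSeq E i' r' d := Nat.sInf_mem hne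
  have hd1 : (d - 1) / 2 = d / 2 := by omega
  have : d ≤ d - 1 := Nat.sInf_le (by simpa [rowSeq, hd1] using hmem)
  omega

/-- The number of levels needed to capture the codes of `n` numbers. -/
def envelopeSize (n : ℕ) : ℕ := (n + n * n) + (n * (n + n * n + 1)) * (n * (n + n * n + 1))

/-- Codes of boundedly many numbers are in the image of boundedly many levels of a strong map. -/
theorem exists_envelope {n : ℕ} (w : Fin n → ℕ) :
    ∃ u : StrongMap, ∀ i, ∃ t, Valid t ∧ t.length < envelopeSize n ∧ u.T t = code E (w i) := by
  classical
  -- `L₁` holds the lengths of the codes and their branching levels. At the levels used, the rows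
  -- must be captured in the binary tree, so their branching levels `L₂` are needed as well. The
  -- process stops there: levels in `L₂` are even, where every code has a zero row, and row `0` is
  -- already included through `R`.
  let L₁ : Finset ℕ := Finset.univ.image (fun i => 2 * w i + 1) ∪
    (Finset.univ ×ˢ Finset.univ).image fun p : Fin n × Fin n =>
      firstDiff (codeRows E (w p.1)) (codeRows E (w p.2))
  let R : Finset ℕ := insert 0 L₁
  let L₂ : Finset ℕ := ((Finset.univ ×ˢ R) ×ˢ (Finset.univ ×ˢ R)).image
    fun p : (Fin n × ℕ) × (Fin n × ℕ) =>
      firstDiff (rowSeq E (w p.1.1) p.1.2) (rowSeq E (w p.2.1) p.2.2)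
  have hL₁ : L₁.card ≤ n + n * n := by
    refine (Finset.card_union_le _ _).trans (Nat.add_le_add ?_ ?_)
    · exact Finset.card_image_le.trans (by simp)
    · exact Finset.card_image_le.trans (by simp)
  have hR : R.card ≤ n + n * n + 1 := (Finset.card_insert_le _ _).trans (Nat.add_le_add_right hL₁ 1)
  have hL₂ : L₂.card ≤ (n * (n + n * n + 1)) * (n * (n + n * n + 1)) := by
    refine Finset.card_image_le.trans ?_
    simp only [Finset.card_product, Finset.card_univ, Fintype.card_fin]
    gcongr
  have hcard : (L₁ ∪ L₂).card ≤ envelopeSize n :=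
    (Finset.card_union_le _ _).trans (Nat.add_le_add hL₁ hL₂)
  obtain ⟨lev, hlev, henum, hmem⟩ := exists_strictMono_enum (L₁ ∪ L₂)
  obtain ⟨u, hu⟩ := exists_capture hlev
    (P := {σ | ∃ i, ∃ r ∈ R, σ = rowSeq E (w i) r}) (Q := {M | ∃ i, M = codeRows E (w i)})
    (J := (L₁ ∪ L₂).card)
    (by
      rintro _ ⟨i, r, hr, rfl⟩ _ ⟨i', r', hr', rfl⟩ -
      obtain ⟨j, -, hj⟩ := henum (firstDiff (rowSeq E (w i) r) (rowSeq E (w i') r'))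
        (Finset.mem_union_right _ (Finset.mem_image.2 ⟨((i, r), (i', r')), by simp [hr, hr'], rfl⟩))
      exact ⟨j, hj⟩)
    (by
      rintro _ ⟨i, rfl⟩
      exact length_codeRows E _)
    (by
      rintro _ ⟨i, rfl⟩ _ ⟨i', rfl⟩ -
      obtain ⟨j, -, hj⟩ := henum (firstDiff (codeRows E (w i)) (codeRows E (w i')))
        (Finset.mem_union_left _ (Finset.mem_union_right _
          (Finset.mem_image.2 ⟨(i, i'), by simp, rfl⟩)))
      exact ⟨j, hj⟩)
    (by
      rintro _ ⟨i, rfl⟩ j hj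
      rcases Finset.mem_union.1 (hmem j hj) with h | h
      · exact ⟨_, ⟨i, lev j, Finset.mem_insert_of_mem h, rfl⟩, rfl⟩
      · obtain ⟨p, -, hp⟩ := Finset.mem_image.1 h
        have heven : lev j % 2 = 0 := by rw [← hp]; exact firstDiff_rowSeq_even _ _ _ _ _
        refine ⟨_, ⟨i, 0, Finset.mem_insert_self _ _, rfl⟩, ?_⟩
        rw [codeRows, rowSeq_even E _ heven])
  refine ⟨u, fun i => ?_⟩
  obtain ⟨j, hj, hji⟩ := henum (2 * w i + 1) (Finset.mem_union_left _ (Finset.mem_union_left _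
    (Finset.mem_image.2 ⟨i, Finset.mem_univ _, rfl⟩)))
  obtain ⟨t, ht, htl, hut⟩ := hu _ ⟨i, rfl⟩ j hj.le
  exact ⟨t, ht, htl ▸ hj.trans_le hcard, by rw [hut, hji, code]⟩

end Coding

end StrongTree

/-! ### The hypergraph on triangular arrays -/

namespace Hypergraph

/-- The composition of embeddings. -/
def Embedding.comp {α β γ : Type*} {A : Hypergraph α} {B : Hypergraph β} {C : Hypergraph γ}
    (g : B.Embedding C) (f : A.Embedding B) : A.Embedding C where
  toFun x := g.toFun (f.toFun x)
  injective := g.injective.comp f.injective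
  map_edge_iff e := by
    rw [← f.map_edge_iff, ← Set.image_image (fun y : V(B) => (y : β)) f.toFun, ← g.map_edge_iff,
      Set.image_image]

theorem Embedding.ext {α β : Type*} {A : Hypergraph α} {B : Hypergraph β} {f g : A.Embedding B}
    (h : ∀ x, f.toFun x = g.toFun x) : f = g := by
  cases f; cases g
  congr
  exact funext h

end Hypergraph

namespace StrongTree

open StrongMap

/-- The entry of `z` in the row given by the length of `y` and the column given by the length
of `x` is `true`. -/
def Rel (x y z : List (List Bool)) : Prop :=
  ∃ a t s, a :: t <:+ z ∧ t.length = y.length ∧ true :: s <:+ a ∧ s.length = x.length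

theorem exists_cons_suffix {γ : Type} {z : List γ} {n : ℕ} (h : n < z.length) :
    ∃ a t, a :: t <:+ z ∧ t.length = n := by
  induction z with
  | nil => simp at h
  | cons a z ih =>
    rcases Nat.lt_succ_iff_lt_or_eq.1 h with h | rfl
    · obtain ⟨b, t, ht, hl⟩ := ih h
      exact ⟨b, t, ht.trans (List.suffix_cons _ _), hl⟩
    · exact ⟨a, z, List.suffix_rfl, rfl⟩

theorem cons_suffix_unique {γ : Type} {a b : γ} {s t z : List γ} (h : a :: s <:+ z)
    (h' : b :: t <:+ z) (hl : s.length = t.length) : a = b ∧ s = t :=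
  List.cons.inj (suffix_eq_of_length_eq h h' (by simp [hl]))

/-- The row of `z` at level `|y|` becomes, up to an extension by `f.B`, the row of `f.T z` at level
`|f.T y|`, by `T_cons`; its bit in column `|x|` is kept in column `|f.T x|`, by `B_cons`. -/
theorem rel_map_iff (f : StrongMap) {x y z : List (List Bool)} (hx : Valid x) (hy : Valid y)
    (hz : Valid z) (hxy : x.length < y.length) (hyz : y.length < z.length) :
    Rel (f.T x) (f.T y) (f.T z) ↔ Rel x y z := by
  obtain ⟨a, t, hat, htl⟩ := exists_cons_suffix hyz
  have hv : Valid (a :: t) := hz.of_suffix hat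
  obtain ⟨b, s, hbs, hsl⟩ := exists_cons_suffix (hxy.trans_eq (htl.symm.trans hv.1.symm))
  have hat' : f.B a :: f.T t <:+ f.T z := (f.T_cons a t hv).trans (f.T_mono hz hat)
  have hbs' : b :: f.B s <:+ f.B a := (f.B_cons b s).trans (f.B_mono hbs)
  have h1 : (f.T t).length = (f.T y).length := by rw [f.length_T _ hv.2, f.length_T _ hy, htl]
  have h2 : (f.B s).length = (f.T x).length := by rw [f.length_B, f.length_T _ hx, hsl]
  constructor
  · rintro ⟨a', t', s', ha', ht', hs', hl'⟩
    obtain ⟨rfl, -⟩ := cons_suffix_unique ha' hat' (ht'.trans h1.symm)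
    obtain ⟨rfl, -⟩ := cons_suffix_unique hs' hbs' (hl'.trans h2.symm)
    exact ⟨a, t, s, hat, htl, hbs, hsl⟩
  · rintro ⟨a', t', s', ha', ht', hs', hl'⟩
    obtain ⟨rfl, -⟩ := cons_suffix_unique ha' hat (ht'.trans htl.symm)
    obtain ⟨rfl, -⟩ := cons_suffix_unique hs' hbs (hl'.trans hsl.symm)
    exact ⟨_, _, _, hat', h1, hbs', h2⟩

/-- Codes have odd lengths, so the entry read off is at row `2j + 1` and column `2i + 1`, where the
padded array holds `E i j k`. -/
theorem rel_code_iff (E : ℕ → ℕ → ℕ → Bool) {i j k : ℕ} (hij : i < j) (hjk : j < k) :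
    Rel (code E i) (code E j) (code E k) ↔ E i j k = true := by
  have hrow : codeRows E k (2 * j + 1) :: initial (codeRows E k) (2 * j + 1) <:+ code E k :=
    initial_suffix (codeRows E k) (m := 2 * j + 1 + 1) (by omega)
  have hcol : rowSeq E k (2 * j + 1) (2 * i + 1) :: initial (rowSeq E k (2 * j + 1)) (2 * i + 1) <:+
      codeRows E k (2 * j + 1) :=
    initial_suffix (rowSeq E k (2 * j + 1)) (m := 2 * i + 1 + 1) (by omega)
  have hval : rowSeq E k (2 * j + 1) (2 * i + 1) = E i j k := by
    have h1 : (2 * j + 1) % 2 = 1 := by omega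
    have h2 : (2 * j + 1) / 2 = j := by omega
    have h3 : (2 * i + 1) / 2 = i := by omega
    simp [rowSeq, h1, h2, h3]
  rw [hval] at hcol
  constructor
  · rintro ⟨a', t', s', ha', ht', hs', hl'⟩
    obtain ⟨rfl, -⟩ := cons_suffix_unique ha' hrow (by rw [ht', length_code, length_initial])
    obtain ⟨h, -⟩ := cons_suffix_unique hs' hcol (by rw [hl', length_code, length_initial])
    exact h.symm
  · intro h
    rw [h] at hcol
    exact ⟨_, _, _, hrow, by rw [length_code, length_initial], hcol,
      by rw [length_code, length_initial]⟩

/-- The 3-uniform hypergraph on the valid lists of rows. -/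
def treeGraph : Hypergraph (List (List Bool)) where
  vertexSet := {t | Valid t}
  edgeSet := {e | ∃ x y z, Valid x ∧ Valid y ∧ Valid z ∧ x.length < y.length ∧
    y.length < z.length ∧ Rel x y z ∧ e = {x, y, z}}
  subset_vertexSet_of_mem_edgeSet' := by
    rintro _ ⟨x, y, z, hx, hy, hz, -, -, -, rfl⟩ t (rfl | rfl | rfl)
    exacts [hx, hy, hz]

theorem treeGraph_isUniform : treeGraph.IsUniform 3 := by
  rintro _ ⟨x, y, z, -, -, -, hxy, hyz, -, rfl⟩
  refine Set.encard_eq_three.2 ⟨x, y, z, ?_, ?_, ?_, rfl⟩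
  · rintro rfl; omega
  · rintro rfl; omega
  · rintro rfl; omega

/-- A map into `treeGraph` that respects the order of levels and the coding of hyperedges is
an embedding. -/
def toTreeGraph {α : Type*} {G : Hypergraph α} (ℓ : V(G) → ℕ) (p : ℕ → ℕ) (hp : StrictMono p)
    (hG : ∀ e : Set V(G), (fun x : V(G) => (x : α)) '' e ∈ E(G) →
      ∃ x y z, ℓ x < ℓ y ∧ ℓ y < ℓ z ∧ e = {x, y, z})
    (g : V(G) → V(treeGraph)) (hg : Function.Injective g) (hlen : ∀ x, (g x).1.length = p (ℓ x))
    (hrel : ∀ x y z, ℓ x < ℓ y → ℓ y < ℓ z →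
      (Rel (g x).1 (g y).1 (g z).1 ↔ ({x.1, y.1, z.1} : Set α) ∈ E(G))) :
    G.Embedding treeGraph where
  toFun := g
  injective := hg
  map_edge_iff e := by
    have himg : ∀ x y z : V(G), (fun x : V(G) => (x : α)) '' {x, y, z} = {x.1, y.1, z.1} := by
      intro x y z
      simp only [Set.image_insert_eq, Set.image_singleton]
    have himg' : ∀ x y z : V(G),
        (fun x : V(G) => (g x).1) '' {x, y, z} = {(g x).1, (g y).1, (g z).1} := by
      intro x y z
      simp only [Set.image_insert_eq, Set.image_singleton]
    have hinj : Function.Injective fun x : V(G) => (g x).1 := Subtype.val_injective.comp hg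
    constructor
    · rintro ⟨X, Y, Z, -, -, -, hXY, hYZ, hR, he⟩
      obtain ⟨x, -, rfl⟩ : X ∈ (fun x : V(G) => (g x).1) '' e := by rw [he]; simp
      obtain ⟨y, -, rfl⟩ : Y ∈ (fun x : V(G) => (g x).1) '' e := by rw [he]; simp
      obtain ⟨z, -, rfl⟩ : Z ∈ (fun x : V(G) => (g x).1) '' e := by rw [he]; simp
      obtain rfl : e = {x, y, z} := hinj.image_injective (he.trans (himg' x y z).symm)
      simp only [hlen, hp.lt_iff_lt] at hXY hYZ
      rw [himg]
      exact (hrel x y z hXY hYZ).1 hR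
    · intro he
      obtain ⟨x, y, z, hxy, hyz, rfl⟩ := hG e he
      rw [himg] at he
      refine ⟨(g x).1, (g y).1, (g z).1, (g x).2, (g y).2, (g z).2, ?_, ?_,
        (hrel x y z hxy hyz).2 he, himg' x y z⟩
      · rw [hlen, hlen]; exact hp hxy
      · rw [hlen, hlen]; exact hp hyz

theorem StrongMap.T_injOn (f : StrongMap) {s t : List (List Bool)} (hs : Valid s) (ht : Valid t)
    (h : f.T s = f.T t) : s = t := by
  refine f.T_injective hs ht (f.lev_strictMono.injective ?_) h
  rw [← f.length_T _ hs, ← f.length_T _ ht, h]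

/-- A strong map as an embedding of `treeGraph` into itself. -/
def StrongMap.toEmbedding (f : StrongMap) : treeGraph.Embedding treeGraph :=
  toTreeGraph (fun x => x.1.length) f.lev f.lev_strictMono
    (by
      rintro e ⟨X, Y, Z, hX, hY, hZ, hXY, hYZ, -, he⟩
      refine ⟨⟨X, hX⟩, ⟨Y, hY⟩, ⟨Z, hZ⟩, hXY, hYZ, ?_⟩
      refine Subtype.val_injective.image_injective (he.trans ?_)
      simp only [Set.image_insert_eq, Set.image_singleton])
    (fun x => ⟨f.T x.1, f.valid_T _ x.2⟩)
    (fun x y h => Subtype.ext (f.T_injOn x.2 y.2 (congrArg Subtype.val h)))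
    (fun x => f.length_T _ x.2)
    (by
      intro x y z hxy hyz
      rw [rel_map_iff f x.2 y.2 z.2 hxy hyz]
      refine ⟨fun h => ⟨_, _, _, x.2, y.2, z.2, hxy, hyz, h, rfl⟩, ?_⟩
      rintro ⟨X, Y, Z, -, -, -, hXY, hYZ, hR, he⟩
      have h1 : X = x.1 ∨ X = y.1 ∨ X = z.1 := by
        have : X ∈ ({x.1, y.1, z.1} : Set (List (List Bool))) := by rw [he]; simp
        simpa using this
      have h2 : Y = x.1 ∨ Y = y.1 ∨ Y = z.1 := by
        have : Y ∈ ({x.1, y.1, z.1} : Set (List (List Bool))) := by rw [he]; simp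
        simpa using this
      have h3 : Z = x.1 ∨ Z = y.1 ∨ Z = z.1 := by
        have : Z ∈ ({x.1, y.1, z.1} : Set (List (List Bool))) := by rw [he]; simp
        simpa using this
      -- Lengths are strictly increasing along both triples, so equality as sets forces equality in
      -- order.
      rcases h1 with rfl | rfl | rfl <;> rcases h2 with rfl | rfl | rfl <;>
        rcases h3 with rfl | rfl | rfl <;> first | exact hR | omega)

theorem exists_sorted_of_encard_eq_three {γ : Type*} {ℓ : γ → ℕ} (hℓ : Function.Injective ℓ)
    {e : Set γ} (he : e.encard = 3) : ∃ x y z, ℓ x < ℓ y ∧ ℓ y < ℓ z ∧ e = {x, y, z} := by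
  obtain ⟨x, y, z, hxy, hxz, hyz, rfl⟩ := Set.encard_eq_three.1 he
  have h1 := hℓ.ne hxy
  have h2 := hℓ.ne hxz
  have h3 := hℓ.ne hyz
  rcases lt_or_gt_of_ne h1 with h1 | h1 <;> rcases lt_or_gt_of_ne h2 with h2 | h2 <;>
    rcases lt_or_gt_of_ne h3 with h3 | h3
  · exact ⟨x, y, z, h1, h3, rfl⟩
  · exact ⟨x, z, y, h2, h3, by rw [Set.pair_comm]⟩
  · omega
  · exact ⟨z, x, y, h2, h1, by rw [Set.insert_comm z, Set.pair_comm z]⟩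
  · exact ⟨y, x, z, h1, h2, by rw [Set.insert_comm]⟩
  · omega
  · exact ⟨y, z, x, h3, h2, by rw [Set.insert_comm, Set.pair_comm]⟩
  · exact ⟨z, y, x, h3, h1, by
      rw [Set.insert_comm z, Set.pair_comm z, Set.insert_comm y]⟩

/-- A countable 3-uniform hypergraph embeds into `treeGraph` by codes. -/
theorem exists_code_embedding {α : Type*} {H : Hypergraph α} (hc : V(H).Countable)
    (hu : H.IsUniform 3) :
    ∃ (E : ℕ → ℕ → ℕ → Bool) (ℓ : V(H) → ℕ) (g : H.Embedding treeGraph),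
      ∀ x, (g.toFun x).1 = code E (ℓ x) := by
  classical
  have : Countable V(H) := hc.to_subtype
  obtain ⟨ℓ, hℓ⟩ := exists_injective_nat V(H)
  let E : ℕ → ℕ → ℕ → Bool := fun i j k =>
    decide (∃ x y z, ℓ x = i ∧ ℓ y = j ∧ ℓ z = k ∧ ({x.1, y.1, z.1} : Set α) ∈ E(H))
  refine ⟨E, ℓ, toTreeGraph ℓ (fun i => 2 * i + 1) (fun i j h => by simp only; omega) ?_
    (fun x => ⟨code E (ℓ x), valid_code E _⟩) ?_ (fun x => length_code E _) ?_, fun x => rfl⟩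
  · intro e he
    refine exists_sorted_of_encard_eq_three hℓ ?_
    exact (Subtype.val_injective.encard_image e).symm.trans (hu _ he)
  · intro x y h
    have := congrArg (fun t => t.1.length) h
    simp only [length_code] at this
    exact hℓ (by omega)
  · intro x y z hxy hyz
    refine (rel_code_iff E hxy hyz).trans ?_
    simp only [E, decide_eq_true_eq]
    constructor
    · rintro ⟨x', y', z', hx, hy, hz, h⟩
      rwa [hℓ hx, hℓ hy, hℓ hz] at h
    · exact fun h => ⟨x, y, z, rfl, rfl, rfl, h⟩

/-! ### Counting the colours -/

/-- Finiteness of the number of colours, for a hypergraph that embeds `treeGraph`. -/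
theorem exists_arrow {α : Type*} {H : Hypergraph α} (hc : V(H).Countable) (hu : H.IsUniform 3)
    (θ : treeGraph.Embedding H) {β : Type*} (A : Hypergraph β) (hA : V(A).Finite) :
    ∃ l : ℕ, ∀ k : ℕ, Hypergraph.Arrow H H A k l := by
  classical
  have : Finite V(A) := hA.to_subtype
  obtain ⟨n, ⟨a⟩⟩ := Finite.exists_equiv_fin V(A)
  obtain ⟨E, ℓ, φ, hφ⟩ := exists_code_embedding hc hu
  -- Position vectors inside an envelope; their number is the bound on the number of colours,
  -- independent of `k`.
  let D := Fin n → {t : List (List Bool) // Valid t ∧ t.length < envelopeSize n}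
  have : Finite {t : List (List Bool) // Valid t ∧ t.length < envelopeSize n} :=
    (finite_valid_lt _).to_subtype
  have : Finite D := Pi.finite
  refine ⟨Nat.card D, fun k χ => ?_⟩
  let Fits : StrongMap → D → A.Embedding H → Prop := fun u d e =>
    ∀ v, e.toFun v = θ.toFun (u.toEmbedding.toFun ⟨(d (a v)).1, (d (a v)).2.1⟩)
  -- The strong map `u` is coloured by the function giving, for each position vector, the colour of
  -- the copy of `A` found there; `none` marks positions that carry no copy.
  let κ : StrongMap → D → Option (Fin k) := fun u d =>
    if h : ∃ e, Fits u d e then some (χ h.choose) else none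
  have hκ : ∀ u d e, Fits u d e → κ u d = some (χ e) := by
    intro u d e he
    have hex : ∃ e, Fits u d e := ⟨e, he⟩
    have : hex.choose = e :=
      Hypergraph.Embedding.ext fun v => (hex.choose_spec v).trans (he v).symm
    simp only [κ, dif_pos hex, this]
  have hloc : Local (envelopeSize n) κ := by
    intro u u' huu'
    funext d
    have : Fits u d = Fits u' d := by
      funext e
      refine propext (forall_congr' fun v => ?_)
      have : u.toEmbedding.toFun ⟨(d (a v)).1, (d (a v)).2.1⟩ =
          u'.toEmbedding.toFun ⟨(d (a v)).1, (d (a v)).2.1⟩ :=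
        Subtype.ext (huu'.T _ (d (a v)).2.1 (d (a v)).2.2)
      rw [this]
    simp only [κ, this]
  obtain ⟨f, ε, hε⟩ := exists_const_comp _ hloc
  refine ⟨θ.comp (f.toEmbedding.comp φ), ?_⟩
  have hsub : some '' (χ '' {e | e.range ⊆ (θ.comp (f.toEmbedding.comp φ)).range}) ⊆
      Set.range ε := by
    rintro _ ⟨_, ⟨e, he, rfl⟩, rfl⟩
    choose w hw using fun v => he ⟨v, rfl⟩
    -- The envelope of the codes shows that the copy `e` sits at some position vector for `f.comp
    -- u`, so its colour is a value of `ε`.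
    obtain ⟨u, hu⟩ := exists_envelope E fun i => ℓ (w (a.symm i))
    choose t ht htl htu using hu
    refine ⟨fun i => ⟨t i, ht i, htl i⟩, ?_⟩
    rw [← hε u]
    refine hκ (f.comp u) (fun i => ⟨t i, ht i, htl i⟩) e fun v => ?_
    rw [← hw v]
    refine congrArg θ.toFun (Subtype.ext ?_)
    change f.T (φ.toFun (w v)).1 = f.T (u.T (t (a v)))
    rw [htu, hφ, a.symm_apply_apply]
  rw [← (Option.some_injective _).encard_image]
  refine (Set.encard_le_encard hsub).trans ?_
  rw [← Set.image_univ]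
  refine (Set.encard_image_le _ _).trans ?_
  rw [Set.encard_univ, ENat.card_eq_coe_natCard]

end StrongTree

theorem theorem1 {α : Type*} (H : Hypergraph α) (hH : H.IsUniversalHomogeneous3) :
    H.HasFiniteBigRamseyDegrees ∧
      ∀ {β : Type*} (A : Hypergraph β), V(A).Finite → A.IsUniform 3 →
        ∃ l : ℕ, ∀ k : ℕ, Hypergraph.Arrow H H A k l := by
  obtain ⟨θ⟩ := hH.universal _ StrongTree.treeGraph (Set.to_countable _)
    StrongTree.treeGraph_isUniform
  refine ⟨fun s _ hs => ?_, fun A hA _ =>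
    StrongTree.exists_arrow hH.countable hH.uniform θ A hA⟩
  obtain ⟨l, hl⟩ := StrongTree.exists_arrow hH.countable hH.uniform θ (H.induce s)
    (hs.subset Set.inter_subset_right)
  exact lt_of_le_of_lt (sInf_le (a := (l : ℕ∞)) hl) (ENat.natCast_lt_top l)
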